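/- An overpartition of $n$ is a partition of $n$ in which the first occurrence of each number may be overlined. For an overpartition $\pi$, let $\ell(\pi)$ be its largest part (with $\ell(\pi)=0$ if $\pi$ is empty) and $n(\pi)$ its number of parts, overlined or not. The rank of $\pi$ is $\ell(\pi)-n(\pi)$, and the $M_2$-rank of $\pi$ is $$\left\lceil \frac{\ell(\pi)}{2}\right\rceil - n(\pi)+n(\pi_o)-\chi(\pi),$$ where $n(\pi_o)$ is the number of odd non-overlined parts of $\pi$, and $\chi(\pi)=1$ if the largest part of $\pi$ is odd and non-overlined, and $\chi(\pi)=0$ otherwise (an overlined $m$ counts as larger than a non-overlined $m$). Let $\overline{NT}(b,k,n)$ (respectively $\overline{NT2}(b,k,n)$) be the total number of parts in the overpartitions of $n$ with rank (respectively $M_2$-rank) congruent to $b$ modulo $k$. **Theorem.** For all integers $n\ge 0$, we have $$\overline{NT}(1,3,3n)-\overline{NT}(2,3,3n)\equiv\overline{NT2}(1,3,3n)-\overline{NT2}(2,3,3n)\pmod 3$$ and $$\overline{NT}(1,3,3n+1)-\overline{NT}(2,3,3n+1)\equiv\overline{NT2}(1,3,3n+1)-\overline{NT2}(2,3,3n+1)\pmod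 3.$$ -/

import Mathlib

/-- An overpartition of `n`: a partition of `n` in which the first occurrence of each number may
be overlined. It is recorded as a partition together with the set of those part sizes whose first
occurrence is overlined. -/
@[ext]
structure Overpartition (n : ℕ) where
  /-- the underlying partition of `n` -/
  toPartition : Nat.Partition n
  /-- the part sizes whose first occurrence is overlined -/
  overlined : Finset ℕ
  /-- only numbers that occur as parts can be overlined -/
  overlined_subset : overlined ⊆ toPartition.parts.toFinset

namespace Overpartition

/-- An overpartition is a partition together with a subset of its set of part sizes. -/
def equivSigma (n : ℕ) :
    (Σ p : Nat.Partition n, {s : Finset ℕ // s ∈ p.parts.toFinset.powerset}) ≃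
      Overpartition n where
  toFun x := ⟨x.1, x.2.1, Finset.mem_powerset.1 x.2.2⟩
  invFun π := ⟨π.toPartition, π.overlined, Finset.mem_powerset.2 π.overlined_subset⟩
  left_inv _ := rfl
  right_inv _ := rfl

instance (n : ℕ) : Fintype (Overpartition n) := Fintype.ofEquiv _ (equivSigma n)

variable {n : ℕ}

/-- The multiset of all parts, overlined or not. -/
def parts (π : Overpartition n) : Multiset ℕ := π.toPartition.parts

/-- The number of parts `n(π)`, overlined or not. -/
def numParts (π : Overpartition n) : ℕ := π.parts.card

/-- The (size of the) largest part `ℓ(π)`; it is `0` for the empty overpartition. -/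
def largestPart (π : Overpartition n) : ℕ := π.parts.sup

/-- The multiset of the non-overlined parts: one copy of each overlined number is removed. -/
def nonOverlinedParts (π : Overpartition n) : Multiset ℕ := π.parts - π.overlined.val

/-- The subpartition `π_o` of the odd non-overlined parts. -/
def oddNonOverlinedParts (π : Overpartition n) : Multiset ℕ :=
  π.nonOverlinedParts.filter (fun i => Odd i)

/-- `χ(π)` is `1` if the largest part is odd and non-overlined, and `0` otherwise. The overlined
occurrence of a number precedes its other occurrences (an overlined `i` counts as larger than a
non-overlined `i`), so the largest part is non-overlined exactly when no part of the largest size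
is overlined. -/
def chi (π : Overpartition n) : ℕ :=
  if Odd π.largestPart ∧ π.largestPart ∉ π.overlined then 1 else 0

/-- Dyson's rank of an overpartition: the largest part minus the number of parts. -/
def rank (π : Overpartition n) : ℤ := (π.largestPart : ℤ) - π.numParts

/-- The `M₂`-rank `⌈ℓ(π) / 2⌉ - n(π) + n(π_o) - χ(π)` of an overpartition. -/
def m2Rank (π : Overpartition n) : ℤ :=
  ⌈(π.largestPart : ℚ) / 2⌉ - (π.numParts : ℤ) + (π.oddNonOverlinedParts.card : ℤ) - (π.chi : ℤ)

/-- The total number of parts in the overpartitions of `n` with rank congruent to `b` modulo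
`k`. -/
def NTbar (b : ℤ) (k n : ℕ) : ℕ :=
  ∑ π : Overpartition n with π.rank ≡ b [ZMOD (k : ℤ)], π.numParts

/-- The total number of parts in the overpartitions of `n` with `M₂`-rank congruent to `b` modulo
`k`. -/
def NT2bar (b : ℤ) (k n : ℕ) : ℕ :=
  ∑ π : Overpartition n with π.m2Rank ≡ b [ZMOD (k : ℤ)], π.numParts

end Overpartition

/-!
Write `n`, `ℓ` and `n_o` for the number of parts, the largest part and the number of odd
non-overlined parts of an overpartition. Modulo `3` a rank `r` is the indicator of `r ≡ 1` minus the
indicator of `r ≡ 2`, so the claim says that the sum of `n (rank - M₂-rank)` over the overpartitions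
of a given size vanishes modulo `3`. Switching the overlining of the largest part averages the
statistic `χ`, and turns twice this sum into the sum of `n (ℓ + n_o)`
(`Overpartition.sum_numParts_mul_rank`). It remains to see that the coefficients of the generating
function of `n (ℓ + n_o)` vanish in `ZMod 3` at all exponents that are not `2` modulo `3`.

This generating function is computed in two steps. Conjugation makes `ℓ` and `n` equidistributed
jointly, and Dyson's adjoint relation (`Overpartition.rankTail_add`) gives the second moment of the
rank, hence the generating function of `n ℓ`, as that of `n ^ 2` minus `P M`, where `P` counts all
overpartitions and `M` is an Appell–Lerch sum (`Overpartition.statGenFun_mul`). Logarithmic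
derivatives of the product formula give the generating function of `n (n + n_o)` as `P E₂`
(`Overpartition.moment_eq`), where `Eₛ = ∑ σ(n) X ^ (s n)`. So the series in question is `P D` with
`D = E₂ - M`, and the claim is the differential equation `δ (P D) = -P D` for the Euler operator
`δ = X d/dX` (`eulerDeriv_genFun_mul`).

Modulo `3`, the operator `δ` is diagonal: it multiplies the part of a series with exponents `≡ i` by
`i`. Since `δ P = 2 P Γ` with `Γ = E₁ - E₂`, the equation follows from `D₀ = Γ D`, where `D₀` is the
part of `D` with exponents divisible by `3`. Let `α` and `β` be the sums of `X ^ (y (y + 1) / 2)`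
over the integers `y` congruent to `0` and to `1` modulo `3`. Three identities involve them:
* Gauss's product for the sum over all `y` gives `δ (β - α) = (β - α) Γ`, that is, `β = (β - α) Γ`
  (`eulerDeriv_psiSeries`, `two_mul_psiSeries`);
* `α M₀ + β M₂ = ∑ N X ^ (3 N (3 N + 1) / 2)` for the two residue parts of `M = M₀ + M₂`
  (`thetaSeries_mul_appell`);
* `-α (E₃ + E₆)` is the same sum (`thetaSeries_mul_sigmaSeries`).

The last two come from one elementary evaluation of an Appell-type sum at the powers of `q`
(`tsum_alternating`), summed over all powers. Together with the part of the first identity that has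
exponents divisible by `3`, they give `α D₀ + β D₂ = 0`, and then `(β - α) D₀ = (β - α) Γ D`, where
`β - α` can be cancelled.
-/

open PowerSeries

/-! ### Overpartitions with bounded parts -/

namespace Overpartition
variable {n : ℕ}

theorem overlined_val_le_parts (π : Overpartition n) : π.overlined.val ≤ π.parts :=
  (Multiset.le_iff_subset π.overlined.nodup).2 fun _ hx =>
    Multiset.mem_toFinset.1 (π.overlined_subset hx)

theorem nonOverlinedParts_add_overlined (π : Overpartition n) :
    π.nonOverlinedParts + π.overlined.val = π.parts :=
  tsub_add_cancel_of_le π.overlined_val_le_parts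

theorem mem_parts_iff {π : Overpartition n} {i : ℕ} :
    i ∈ π.parts ↔ i ∈ π.nonOverlinedParts ∨ i ∈ π.overlined := by
  rw [← nonOverlinedParts_add_overlined, Multiset.mem_add, Finset.mem_val]

theorem largestPart_le_iff {π : Overpartition n} {N : ℕ} :
    π.largestPart ≤ N ↔ ∀ i ∈ π.parts, i ≤ N := Multiset.sup_le

theorem pos_of_mem_parts {π : Overpartition n} {i : ℕ} (h : i ∈ π.parts) : 0 < i :=
  π.toPartition.parts_pos h

theorem sum_parts (π : Overpartition n) : π.parts.sum = n := π.toPartition.parts_sum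

theorem le_of_mem_parts {π : Overpartition n} {i : ℕ} (h : i ∈ π.parts) : i ≤ n :=
  (Multiset.le_sum_of_mem h).trans_eq π.sum_parts

theorem largestPart_le (π : Overpartition n) : π.largestPart ≤ n :=
  largestPart_le_iff.2 fun _ => le_of_mem_parts

theorem numParts_le (π : Overpartition n) : π.numParts ≤ n := by
  have h := Multiset.card_nsmul_le_sum (s := π.parts) (a := 1) fun x hx => pos_of_mem_parts hx
  rw [π.sum_parts] at h
  simpa [numParts] using h

theorem ext_of_parts {π ρ : Overpartition n} (h : π.parts = ρ.parts)
    (h' : π.overlined = ρ.overlined) : π = ρ :=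
  Overpartition.ext (Nat.Partition.ext h) h'

/-- Add a non-overlined part `i`. -/
def addPlain (i : ℕ) (hi : 0 < i) (π : Overpartition n) : Overpartition (n + i) where
  toPartition :=
    { parts := i ::ₘ π.parts
      parts_pos := fun {j} hj => by
        rcases Multiset.mem_cons.1 hj with rfl | hj
        exacts [hi, pos_of_mem_parts hj]
      parts_sum := by rw [Multiset.sum_cons, π.sum_parts, add_comm] }
  overlined := π.overlined
  overlined_subset := fun x hx => Multiset.mem_toFinset.2 <|
    Multiset.mem_cons_of_mem (Multiset.mem_toFinset.1 (π.overlined_subset hx))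

/-- Add an overlined part `i` to an overpartition which has no part `i`. -/
def addOverlined (i : ℕ) (hi : 0 < i) (π : Overpartition n) : Overpartition (n + i) where
  toPartition := (addPlain i hi π).toPartition
  overlined := insert i π.overlined
  overlined_subset := fun x hx => by
    rcases Finset.mem_insert.1 hx with rfl | hx
    · exact Multiset.mem_toFinset.2 (Multiset.mem_cons_self _ _)
    · exact (addPlain i hi π).overlined_subset hx

section add
variable (i : ℕ) (hi : 0 < i) (π : Overpartition n)

@[simp] theorem parts_addPlain : (addPlain i hi π).parts = i ::ₘ π.parts := rfl
@[simp] theorem parts_addOverlined : (addOverlined i hi π).parts = i ::ₘ π.parts := rfl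
@[simp] theorem overlined_addOverlined :
    (addOverlined i hi π).overlined = insert i π.overlined := rfl
@[simp] theorem numParts_addPlain : (addPlain i hi π).numParts = π.numParts + 1 := by
  simp [numParts]
@[simp] theorem numParts_addOverlined : (addOverlined i hi π).numParts = π.numParts + 1 := by
  simp [numParts]

@[simp] theorem nonOverlinedParts_addPlain :
    (addPlain i hi π).nonOverlinedParts = i ::ₘ π.nonOverlinedParts :=
  Multiset.cons_sub_of_le _ π.overlined_val_le_parts

variable {i π} in
theorem nonOverlinedParts_addOverlined (h : i ∉ π.parts) :
    (addOverlined i hi π).nonOverlinedParts = π.nonOverlinedParts := by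
  have h' : i ∉ π.overlined := fun h' => h (mem_parts_iff.2 (Or.inr h'))
  simp only [nonOverlinedParts, parts_addOverlined, overlined_addOverlined,
    Finset.insert_val_of_notMem h']
  rw [← Multiset.singleton_add, ← Multiset.singleton_add, add_tsub_add_eq_tsub_left]

end add

/-- The number `n(π_o)` of odd non-overlined parts. -/
def numOddPlain (π : Overpartition n) : ℕ := π.oddNonOverlinedParts.card

theorem numOddPlain_addPlain (i : ℕ) (hi : 0 < i) (π : Overpartition n) :
    (addPlain i hi π).numOddPlain = π.numOddPlain + i % 2 := by
  simp only [numOddPlain, oddNonOverlinedParts, nonOverlinedParts_addPlain]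
  by_cases h : Odd i
  · rw [Multiset.filter_cons_of_pos _ h, Multiset.card_cons, Nat.odd_iff.1 h]
  · rw [Multiset.filter_cons_of_neg _ h, Nat.even_iff.1 (Nat.not_odd_iff_even.1 h), add_zero]

theorem numOddPlain_addOverlined {i : ℕ} (hi : 0 < i) {π : Overpartition n} (h : i ∉ π.parts) :
    (addOverlined i hi π).numOddPlain = π.numOddPlain := by
  simp only [numOddPlain, oddNonOverlinedParts, nonOverlinedParts_addOverlined hi h]

/-- Removing a non-overlined part `i` that is a largest part. -/
theorem sum_mem_nonOverlinedParts {A : Type*} [AddCommMonoid A] (i : ℕ) (hi : 0 < i)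
    (f : ℕ → ℕ → A) :
    ∑ π : Overpartition (n + i) with π.largestPart ≤ i ∧ i ∈ π.nonOverlinedParts,
        f π.numParts π.numOddPlain =
      ∑ π : Overpartition n with π.largestPart ≤ i,
        f (π.numParts + 1) (π.numOddPlain + i % 2) := by
  symm
  refine Finset.sum_bij (fun π _ => addPlain i hi π) ?_ ?_ ?_ ?_
  · intro π hπ
    simp only [Finset.mem_filter, Finset.mem_univ, true_and, largestPart_le_iff] at hπ ⊢
    refine ⟨fun j hj => ?_, by simp⟩
    rcases Multiset.mem_cons.1 hj with rfl | hj
    exacts [le_rfl, hπ j hj]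
  · intro π _ ρ _ h
    have h' : (addPlain i hi π).overlined = (addPlain i hi ρ).overlined := congrArg overlined h
    exact ext_of_parts ((Multiset.cons_inj_right i).1 (congrArg parts h)) h'
  · intro π hπ
    simp only [Finset.mem_filter, Finset.mem_univ, true_and, largestPart_le_iff] at hπ
    obtain ⟨h1, h2⟩ := hπ
    have hmem : i ∈ π.parts := mem_parts_iff.2 (Or.inl h2)
    have hle : π.overlined.val ≤ π.parts.erase i := by
      obtain ⟨t, ht⟩ := Multiset.exists_cons_of_mem h2
      rw [← nonOverlinedParts_add_overlined, ht, Multiset.cons_add, Multiset.erase_cons_head]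
      exact Multiset.le_add_left _ _
    refine ⟨⟨⟨π.parts.erase i, fun hj => pos_of_mem_parts (Multiset.mem_of_mem_erase hj), ?_⟩,
      π.overlined, fun x hx => Multiset.mem_toFinset.2 (Multiset.mem_of_le hle hx)⟩, ?_, ?_⟩
    · have := Multiset.sum_erase hmem
      rw [π.sum_parts] at this
      omega
    · simp only [Finset.mem_filter, Finset.mem_univ, true_and, largestPart_le_iff]
      exact fun j hj => h1 j (Multiset.mem_of_mem_erase hj)
    · exact ext_of_parts (Multiset.cons_erase hmem) rfl
  · intro π _
    rw [numParts_addPlain, numOddPlain_addPlain]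

/-- Removing the overlined part `i` when it is the only part of size `i`, and the largest. -/
theorem sum_mem_overlined {A : Type*} [AddCommMonoid A] (N : ℕ) (f : ℕ → ℕ → A) :
    ∑ π : Overpartition (n + (N + 1)) with π.largestPart ≤ N + 1 ∧
        N + 1 ∉ π.nonOverlinedParts ∧ N + 1 ∈ π.overlined, f π.numParts π.numOddPlain =
      ∑ π : Overpartition n with π.largestPart ≤ N, f (π.numParts + 1) π.numOddPlain := by
  symm
  have hN : ∀ π : Overpartition n, π.largestPart ≤ N → N + 1 ∉ π.parts := fun π hπ h => by
    have := largestPart_le_iff.1 hπ _ h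
    omega
  refine Finset.sum_bij (fun π _ => addOverlined (N + 1) N.succ_pos π) ?_ ?_ ?_ ?_
  · intro π hπ
    simp only [Finset.mem_filter, Finset.mem_univ, true_and] at hπ ⊢
    rw [nonOverlinedParts_addOverlined _ (hN π hπ)]
    refine ⟨largestPart_le_iff.2 fun j hj => ?_, fun h => hN π hπ (mem_parts_iff.2 (Or.inl h)),
      by simp⟩
    rcases Multiset.mem_cons.1 hj with rfl | hj
    exacts [le_rfl, (largestPart_le_iff.1 hπ j hj).trans N.le_succ]
  · intro π hπ ρ hρ h
    simp only [Finset.mem_filter, Finset.mem_univ, true_and] at hπ hρ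
    refine ext_of_parts ((Multiset.cons_inj_right (N + 1)).1 (congrArg parts h)) ?_
    have h1 : N + 1 ∉ π.overlined := fun h' => hN π hπ (mem_parts_iff.2 (Or.inr h'))
    have h2 : N + 1 ∉ ρ.overlined := fun h' => hN ρ hρ (mem_parts_iff.2 (Or.inr h'))
    have := congrArg (fun s => Finset.erase s (N + 1)) (congrArg overlined h)
    simpa [Finset.erase_insert h1, Finset.erase_insert h2] using this
  · intro π hπ
    simp only [Finset.mem_filter, Finset.mem_univ, true_and, largestPart_le_iff] at hπ
    obtain ⟨h1, h2, h3⟩ := hπ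
    have hmem : N + 1 ∈ π.parts := mem_parts_iff.2 (Or.inr h3)
    have herase : π.parts.erase (N + 1) =
        π.nonOverlinedParts + (π.overlined.erase (N + 1)).val := by
      rw [← nonOverlinedParts_add_overlined, Multiset.erase_add_right_neg _ h2, Finset.erase_val]
    have hnot : N + 1 ∉ π.parts.erase (N + 1) := by
      rw [herase, Multiset.mem_add, Finset.mem_val]
      simp [h2]
    refine ⟨⟨⟨π.parts.erase (N + 1), fun hj => pos_of_mem_parts (Multiset.mem_of_mem_erase hj), ?_⟩,
      π.overlined.erase (N + 1), fun x hx => Multiset.mem_toFinset.2 ?_⟩, ?_, ?_⟩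
    · have := Multiset.sum_erase hmem
      rw [π.sum_parts] at this
      omega
    · change x ∈ π.parts.erase (N + 1)
      rw [herase, Multiset.mem_add]
      exact Or.inr hx
    · simp only [Finset.mem_filter, Finset.mem_univ, true_and, largestPart_le_iff]
      intro j hj
      have := h1 j (Multiset.mem_of_mem_erase hj)
      have hne : j ≠ N + 1 := fun h => hnot (h ▸ hj)
      omega
    · exact ext_of_parts (Multiset.cons_erase hmem) (Finset.insert_erase h3)
  · intro π hπ
    simp only [Finset.mem_filter, Finset.mem_univ, true_and] at hπ
    rw [numParts_addOverlined, numOddPlain_addOverlined _ (hN π hπ)]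

/-- The generating function of the overpartitions with all parts at most `N`, each counted with
the weight `f (n(π)) (n(π_o))`. -/
noncomputable def boundedGenFun {R : Type*} [CommRing R] (N : ℕ) (f : ℕ → ℕ → R) : R⟦X⟧ :=
  PowerSeries.mk fun n => ∑ π : Overpartition n with π.largestPart ≤ N, f π.numParts π.numOddPlain

/-- Case distinction on the parts of size `N + 1`: there is none, there is an overlined one only,
or there is a non-overlined one, which can be removed. -/
theorem boundedGenFun_succ {R : Type*} [CommRing R] (N : ℕ) (f : ℕ → ℕ → R) :
    boundedGenFun (N + 1) f = boundedGenFun N f +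
      X ^ (N + 1) * boundedGenFun N (fun a b => f (a + 1) b) +
      X ^ (N + 1) * boundedGenFun (N + 1) (fun a b => f (a + 1) (b + (N + 1) % 2)) := by
  ext n
  have h0 : ∀ π : Overpartition n, π.largestPart ≤ N + 1 →
      (π.largestPart ≤ N ↔ N + 1 ∉ π.nonOverlinedParts ∧ N + 1 ∉ π.overlined) := by
    intro π hπ
    rw [← not_or, ← mem_parts_iff, largestPart_le_iff]
    rw [largestPart_le_iff] at hπ
    refine ⟨fun h h' => by have := h _ h'; omega, fun h j hj => ?_⟩
    have := hπ j hj
    have hne : j ≠ N + 1 := fun h' => h (h' ▸ hj)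
    omega
  have split : coeff n (boundedGenFun (N + 1) f) =
      (∑ π : Overpartition n with π.largestPart ≤ N, f π.numParts π.numOddPlain) +
      (∑ π : Overpartition n with π.largestPart ≤ N + 1 ∧ N + 1 ∉ π.nonOverlinedParts ∧
        N + 1 ∈ π.overlined, f π.numParts π.numOddPlain) +
      ∑ π : Overpartition n with π.largestPart ≤ N + 1 ∧ N + 1 ∈ π.nonOverlinedParts,
        f π.numParts π.numOddPlain := by
    rw [boundedGenFun, coeff_mk]
    simp only [Finset.sum_filter]
    rw [← Finset.sum_add_distrib, ← Finset.sum_add_distrib]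
    refine Finset.sum_congr rfl fun π _ => ?_
    by_cases h : π.largestPart ≤ N + 1
    · have h1 := h0 π h
      by_cases h2 : N + 1 ∈ π.nonOverlinedParts <;> by_cases h3 : N + 1 ∈ π.overlined <;>
        simp [h, h1, h2, h3]
    · have h1 : ¬ π.largestPart ≤ N := fun h' => h (h'.trans N.le_succ)
      simp [h, h1]
  rw [split, map_add, map_add]
  refine congrArg₂ (· + ·) (congrArg₂ (· + ·) ?_ ?_) ?_
  · rw [boundedGenFun, coeff_mk]
  · rw [coeff_X_pow_mul']
    split_ifs with h
    · obtain ⟨m, rfl⟩ := Nat.exists_eq_add_of_le' h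
      rw [sum_mem_overlined, Nat.add_sub_cancel, boundedGenFun, coeff_mk]
    · refine Finset.sum_eq_zero fun π hπ => absurd ?_ h
      simp only [Finset.mem_filter] at hπ
      exact le_of_mem_parts (mem_parts_iff.2 (Or.inr hπ.2.2.2))
  · rw [coeff_X_pow_mul']
    split_ifs with h
    · obtain ⟨m, rfl⟩ := Nat.exists_eq_add_of_le' h
      rw [sum_mem_nonOverlinedParts _ N.succ_pos, Nat.add_sub_cancel, boundedGenFun, coeff_mk]
    · refine Finset.sum_eq_zero fun π hπ => absurd ?_ h
      simp only [Finset.mem_filter] at hπ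
      exact le_of_mem_parts (mem_parts_iff.2 (Or.inl hπ.2.2))

end Overpartition

/-! ### Joint distribution of the largest part and the number of parts -/

namespace Overpartition

section CommRing
variable {R : Type*} [CommRing R] {n : ℕ}

theorem largestPart_eq_zero {π : Overpartition n} (h : π.numParts = 0) : π.largestPart = 0 := by
  have h' : π.parts = 0 := Multiset.card_eq_zero.1 h
  simp [largestPart, h']

theorem boundedGenFun_zero (f : ℕ → ℕ → R) : boundedGenFun 0 f = C (f 0 0) := by
  have key : ∀ {m : ℕ} (π : Overpartition m), π.largestPart ≤ 0 → π.parts = 0 := fun π hπ =>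
    Multiset.eq_zero_of_forall_notMem fun i hi => by
      have h1 := largestPart_le_iff.1 hπ i hi
      have h2 := pos_of_mem_parts hi
      omega
  ext n
  rw [boundedGenFun, coeff_mk, coeff_C]
  split_ifs with hn
  · subst hn
    have h0 : ∀ π : Overpartition 0, π.parts = 0 := fun π => key π π.largestPart_le
    have hO : ∀ π : Overpartition 0, π.overlined = ∅ := fun π =>
      Finset.eq_empty_of_forall_notMem fun i hi => by
        have := mem_parts_iff.2 (Or.inr hi)
        simp [h0] at this
    let π₀ : Overpartition 0 := ⟨⟨0, fun h => by simp at h, by simp⟩, ∅, by simp⟩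
    have huniv : (Finset.univ.filter fun π : Overpartition 0 => π.largestPart ≤ 0) = {π₀} := by
      ext π
      simp only [Finset.mem_filter, Finset.mem_univ, true_and, Finset.mem_singleton]
      exact ⟨fun _ => ext_of_parts ((h0 π).trans (h0 π₀).symm) ((hO π).trans (hO π₀).symm),
        fun _ => π.largestPart_le⟩
    rw [huniv, Finset.sum_singleton]
    rfl
  · refine Finset.sum_eq_zero fun π hπ => absurd ?_ hn
    rw [← π.sum_parts, key π (Finset.mem_filter.1 hπ).2, Multiset.sum_zero]

/-- The generating function of the overpartitions, each counted with the weight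
`f (ℓ(π)) (n(π))`. -/
noncomputable def statGenFun (f : ℕ → ℕ → R) : R⟦X⟧ :=
  PowerSeries.mk fun n => ∑ π : Overpartition n, f π.largestPart π.numParts

theorem coeff_statGenFun_congr {n : ℕ} {f g : ℕ → ℕ → R}
    (h : ∀ l a, l ≤ n → a ≤ n → (a = 0 → l = 0) → f l a = g l a) :
    coeff n (statGenFun f) = coeff n (statGenFun g) := by
  rw [statGenFun, statGenFun, coeff_mk, coeff_mk]
  exact Finset.sum_congr rfl fun π _ =>
    h _ _ π.largestPart_le π.numParts_le largestPart_eq_zero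

theorem statGenFun_add (f g : ℕ → ℕ → R) :
    statGenFun (fun l a => f l a + g l a) = statGenFun f + statGenFun g := by
  ext n
  simp [statGenFun, Finset.sum_add_distrib]

theorem statGenFun_sub (f g : ℕ → ℕ → R) :
    statGenFun (fun l a => f l a - g l a) = statGenFun f - statGenFun g := by
  ext n
  simp [statGenFun, Finset.sum_sub_distrib]

theorem statGenFun_const_mul (c : R) (f : ℕ → ℕ → R) :
    statGenFun (fun l a => c * f l a) = C c * statGenFun f := by
  ext n
  simp [statGenFun, Finset.mul_sum]

theorem statGenFun_sum {ι : Type*} (s : Finset ι) (f : ι → ℕ → ℕ → R) :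
    statGenFun (fun l a => ∑ i ∈ s, f i l a) = ∑ i ∈ s, statGenFun (f i) := by
  ext n
  simp only [statGenFun, coeff_mk, map_sum]
  exact Finset.sum_comm

variable (R) in
/-- The generating function of the overpartitions with all parts at most `N` and at most `K`
parts: the overpartition analogue of a Gaussian binomial coefficient. -/
noncomputable def boxGenFun (N K : ℕ) : R⟦X⟧ :=
  statGenFun fun l a => if l ≤ N ∧ a ≤ K then 1 else 0

theorem boxGenFun_eq (N K : ℕ) :
    boxGenFun R N K = boundedGenFun N fun a _ => if a ≤ K then 1 else 0 := by
  ext n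
  simp only [boxGenFun, statGenFun, boundedGenFun, coeff_mk, Finset.sum_filter, ite_and]

theorem boxGenFun_zero_left (K : ℕ) : boxGenFun R 0 K = 1 := by
  rw [boxGenFun_eq, boundedGenFun_zero]
  simp

/-- Removing the largest part. -/
theorem boxGenFun_succ_left (N K : ℕ) :
    boxGenFun R (N + 1) (K + 1) = boxGenFun R N (K + 1) +
      X ^ (N + 1) * (boxGenFun R N K + boxGenFun R (N + 1) K) := by
  simp only [boxGenFun_eq]
  rw [boundedGenFun_succ]
  simp only [Nat.add_le_add_iff_right]
  ring

theorem boxGenFun_zero_right (N : ℕ) : boxGenFun R N 0 = 1 := by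
  induction N with
  | zero => exact boxGenFun_zero_left 0
  | succ N ih =>
    rw [boxGenFun_eq] at ih ⊢
    have h : ∀ M, boundedGenFun M (fun _ _ => (0 : R)) = 0 := fun M => by
      ext n
      simp [boundedGenFun]
    rw [boundedGenFun_succ, ih]
    simp [h]

/-- Removing one cell from each part. -/
theorem boxGenFun_succ_right (N K : ℕ) :
    boxGenFun R (N + 1) (K + 1) = boxGenFun R (N + 1) K +
      X ^ (K + 1) * (boxGenFun R N (K + 1) + boxGenFun R N K) := by
  induction N generalizing K with
  | zero =>
    simp only [boxGenFun_zero_left]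
    induction K with
    | zero =>
      have h := boxGenFun_succ_left (R := R) 0 0
      simp only [boxGenFun_zero_left, boxGenFun_zero_right] at h ⊢
      linear_combination h
    | succ K ih =>
      have h := boxGenFun_succ_left (R := R) 0 (K + 1)
      have h' := boxGenFun_succ_left (R := R) 0 K
      simp only [boxGenFun_zero_left] at h h'
      linear_combination h - h' + X * ih
  | succ N ih =>
    induction K with
    | zero =>
      have h1 := ih 0
      have h2 := boxGenFun_succ_left (R := R) N 0
      have h3 := boxGenFun_succ_left (R := R) (N + 1) 0
      simp only [boxGenFun_zero_right] at h1 h2 h3 ⊢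
      linear_combination h3 + h1 - X * h2
    | succ K ihK =>
      linear_combination ih (K + 1) + X ^ (N + 2) * (ihK + ih K) +
        boxGenFun_succ_left (R := R) (N + 1) (K + 1) - boxGenFun_succ_left (R := R) (N + 1) K -
        X ^ (K + 2) * (boxGenFun_succ_left (R := R) N (K + 1) + boxGenFun_succ_left (R := R) N K)

/-- Conjugation. -/
theorem boxGenFun_symm (N K : ℕ) : boxGenFun R N K = boxGenFun R K N := by
  induction N generalizing K with
  | zero => rw [boxGenFun_zero_left, boxGenFun_zero_right]
  | succ N ihN =>
    induction K with
    | zero => rw [boxGenFun_zero_left, boxGenFun_zero_right]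
    | succ K ihK =>
      rw [boxGenFun_succ_left, boxGenFun_succ_right, ihN, ihN, ihK]
      ring

variable (R) in
/-- The generating function of the overpartitions with largest part `N` and exactly `K` parts. -/
noncomputable def exactGenFun (N K : ℕ) : R⟦X⟧ :=
  statGenFun fun l a => if l = N ∧ a = K then 1 else 0

theorem exactGenFun_symm (N K : ℕ) : exactGenFun R N K = exactGenFun R K N := by
  have h : ∀ N K, exactGenFun R (N + 1) (K + 1) = boxGenFun R (N + 1) (K + 1) -
      boxGenFun R N (K + 1) - (boxGenFun R (N + 1) K - boxGenFun R N K) := fun N K => by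
    simp only [boxGenFun, exactGenFun, ← statGenFun_sub]
    congr 1
    funext l a
    split_ifs <;> first | omega | simp
  have h0 : ∀ N, exactGenFun R (N + 1) 0 = boxGenFun R (N + 1) 0 - boxGenFun R N 0 := fun N => by
    simp only [boxGenFun, exactGenFun, ← statGenFun_sub]
    congr 1
    funext l a
    split_ifs <;> first | omega | simp
  have h0' : ∀ N, exactGenFun R 0 (N + 1) = boxGenFun R 0 (N + 1) - boxGenFun R 0 N := fun N => by
    simp only [boxGenFun, exactGenFun, ← statGenFun_sub]
    congr 1
    funext l a
    split_ifs <;> first | omega | simp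
  rcases N with _ | N <;> rcases K with _ | K
  · rfl
  · rw [h0, h0', boxGenFun_symm 0, boxGenFun_symm 0]
  · rw [h0, h0', boxGenFun_symm 0, boxGenFun_symm 0]
  · rw [h, h, boxGenFun_symm (N + 1) (K + 1), boxGenFun_symm N (K + 1), boxGenFun_symm (N + 1) K,
      boxGenFun_symm N K]
    ring

/-- The largest part and the number of parts are equidistributed jointly. -/
theorem statGenFun_swap (f : ℕ → ℕ → R) :
    statGenFun f = statGenFun fun l a => f a l := by
  have key : ∀ (g : ℕ → ℕ → R) (n : ℕ), coeff n (statGenFun g) =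
      ∑ i ∈ Finset.range (n + 1), ∑ j ∈ Finset.range (n + 1),
        g i j * coeff n (exactGenFun R i j) := by
    intro g n
    have h : ∀ i j, g i j * coeff n (exactGenFun R i j) =
        coeff n (statGenFun fun l a => g i j * if l = i ∧ a = j then 1 else 0) := fun i j => by
      rw [statGenFun_const_mul, coeff_C_mul, exactGenFun]
    simp only [h, ← map_sum, ← statGenFun_sum]
    refine coeff_statGenFun_congr fun l a hl ha _ => ?_
    rw [Finset.sum_eq_single l, Finset.sum_eq_single a]
    · simp
    · intro j _ hj
      rw [if_neg fun h => hj h.2.symm, mul_zero]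
    · intro h
      exact absurd (Finset.mem_range.2 (by omega)) h
    · intro i _ hi
      exact Finset.sum_eq_zero fun j _ => by rw [if_neg fun h => hi h.1.symm, mul_zero]
    · intro h
      exact absurd (Finset.mem_range.2 (by omega)) h
  ext n
  rw [key, key, Finset.sum_comm]
  simp only [exactGenFun_symm (R := R)]

variable (R) in
/-- The number of overpartitions of rank at least `m`, plus the number of overpartitions of rank
at least `m + 1`. -/
noncomputable def rankTail (m : ℕ) : R⟦X⟧ :=
  statGenFun fun l a => (if a + m ≤ l then 1 else 0) + if a + m + 1 ≤ l then 1 else 0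

variable (R) in
/-- The generating function of the overpartitions. -/
noncomputable def genFun : R⟦X⟧ := statGenFun fun _ _ => 1

/-- The identity that becomes Dyson's adjoint relation for ranks after summation over `k`: on the
left, the overpartitions with `k` parts, on the right those with largest part `k + m + 1`. -/
theorem adjoint_layer (m k : ℕ) :
    X ^ (m + 1) * (statGenFun (R := R) fun l a =>
        if a = k then (if l ≤ k + m + 1 then 1 else 0) + (if l ≤ k + m + 2 then 1 else 0) else 0) =
      statGenFun (R := R) fun l a =>
        if l = k + m + 1 then (if a ≤ k + 1 then 1 else 0) + (if a ≤ k then 1 else 0) else 0 := by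
  have hr : (statGenFun (R := R) fun l a =>
        if l = k + m + 1 then (if a ≤ k + 1 then 1 else 0) + (if a ≤ k then 1 else 0) else 0) =
      (boxGenFun R (k + m + 1) (k + 1) - boxGenFun R (k + m) (k + 1)) +
        (boxGenFun R (k + m + 1) k - boxGenFun R (k + m) k) := by
    simp only [boxGenFun, ← statGenFun_sub, ← statGenFun_add]
    congr 1
    funext l a
    split_ifs <;> first | omega | simp
  rw [hr]
  rcases k with _ | k
  · have hl : (statGenFun (R := R) fun l a =>
        if a = 0 then (if l ≤ 0 + m + 1 then 1 else 0) + (if l ≤ 0 + m + 2 then 1 else 0) else 0) =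
        boxGenFun R (m + 1) 0 + boxGenFun R (m + 2) 0 := by
      simp only [boxGenFun, ← statGenFun_add]
      congr 1
      funext l a
      split_ifs <;> first | omega | simp
    rw [hl]
    have h := boxGenFun_succ_left (R := R) m 0
    simp only [boxGenFun_zero_right, zero_add] at h ⊢
    linear_combination -h
  · have hl : (statGenFun (R := R) fun l a => if a = k + 1 then
          (if l ≤ k + 1 + m + 1 then 1 else 0) + (if l ≤ k + 1 + m + 2 then 1 else 0) else 0) =
        (boxGenFun R (k + 1 + m + 1) (k + 1) - boxGenFun R (k + 1 + m + 1) k) +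
          (boxGenFun R (k + 1 + m + 2) (k + 1) - boxGenFun R (k + 1 + m + 2) k) := by
      simp only [boxGenFun, ← statGenFun_sub, ← statGenFun_add]
      congr 1
      funext l a
      split_ifs <;> first | omega | simp
    rw [hl]
    have h1 := boxGenFun_succ_right (R := R) (k + 1 + m) k
    have h2 := boxGenFun_succ_right (R := R) (k + 1 + m + 1) k
    have h3 := boxGenFun_succ_left (R := R) (k + 1 + m) (k + 1)
    have h4 := boxGenFun_succ_left (R := R) (k + 1 + m) k
    linear_combination X ^ (m + 1) * (h1 + h2) - h3 - h4

/-- Dyson's adjoint relation for the ranks of overpartitions. -/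
theorem rankTail_add (m : ℕ) (hm : 0 < m) :
    rankTail R m + X ^ (m + 1) * rankTail R (m + 2) = 2 * X ^ (m + 1) * genFun R := by
  have key : rankTail R m = X ^ (m + 1) * statGenFun (R := R) fun l a =>
      (if l ≤ a + m + 1 then 1 else 0) + (if l ≤ a + m + 2 then 1 else 0) := by
    ext n
    have h := congrArg (coeff n) (Finset.sum_congr (rfl : Finset.range (n + 1) = _)
      fun k _ => adjoint_layer (R := R) m k)
    rw [← Finset.mul_sum, ← statGenFun_sum, ← statGenFun_sum] at h
    have hl : coeff n (rankTail R m) = coeff n (statGenFun (R := R) fun l a =>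
        ∑ k ∈ Finset.range (n + 1),
          if l = k + m + 1 then (if a ≤ k + 1 then 1 else 0) + (if a ≤ k then 1 else 0) else 0) := by
      refine coeff_statGenFun_congr fun l a hl ha h0 => ?_
      by_cases hlm : m + 1 ≤ l
      · rw [Finset.sum_eq_single (l - (m + 1))]
        · have hl' : l = l - (m + 1) + m + 1 := by omega
          rw [if_pos hl']
          congr 1 <;> exact if_congr (by omega) rfl rfl
        · intro k _ hk
          rw [if_neg (by omega)]
        · intro h
          exact absurd (Finset.mem_range.2 (by omega)) h
      · rw [if_neg (by omega), if_neg (by omega), add_zero]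
        exact (Finset.sum_eq_zero fun k _ => by rw [if_neg (by omega)]).symm
    rw [hl, ← h, coeff_X_pow_mul', coeff_X_pow_mul']
    split_ifs with hn
    · refine coeff_statGenFun_congr fun l a hl ha h0 => ?_
      rw [Finset.sum_eq_single a]
      · rw [if_pos rfl]
      · intro k _ hk
        rw [if_neg (Ne.symm hk)]
      · intro h
        exact absurd (Finset.mem_range.2 (by omega)) h
    · rfl
  have key' : (statGenFun (R := R) fun l a =>
      (if l ≤ a + m + 1 then 1 else 0) + (if l ≤ a + m + 2 then 1 else 0)) =
      C 2 * genFun R - rankTail R (m + 2) := by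
    rw [genFun, rankTail, ← statGenFun_const_mul, ← statGenFun_sub]
    congr 1
    funext l a
    split_ifs <;> first | omega | norm_num
  rw [key, key', show (C (2 : R) : R⟦X⟧) = 2 from map_ofNat _ 2]
  ring

end CommRing
end Overpartition

/-! ### The second moment of the rank as an Appell–Lerch sum -/

open scoped PowerSeries.WithPiTopology

section Summability
variable {ι : Type*}

theorem PowerSeries.summable_of_X_pow_dvd {R : Type*} [CommRing R] [TopologicalSpace R]
    {f : ι → R⟦X⟧} (e : ι → ℕ) (he : ∀ B, {i | e i ≤ B}.Finite) (h : ∀ i, X ^ e i ∣ f i) :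
    Summable f := by
  rw [WithPiTopology.summable_iff_summable_coeff]
  intro n
  refine summable_of_hasFiniteSupport ((he n).subset fun i hi => ?_)
  by_contra hn
  exact hi (X_pow_dvd_iff.1 (h i) n (not_le.1 hn))

theorem ZMod.three_eq_zero_powerSeries : (3 : (ZMod 3)⟦X⟧) = 0 := by
  have : (C (3 : ZMod 3)) = (3 : (ZMod 3)⟦X⟧) := map_ofNat _ 3
  rw [← this, show (3 : ZMod 3) = 0 from rfl, map_zero]

instance : Fact (Nat.Prime 3) := ⟨Nat.prime_three⟩

theorem one_sub_X_pow_mul_inv {n : ℕ} (hn : n ≠ 0) :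
    (1 - X ^ n : (ZMod 3)⟦X⟧) * (1 - X ^ n)⁻¹ = 1 :=
  PowerSeries.mul_inv_cancel _ (by simp [hn])

end Summability

/-- The Lambert term `∑ m X ^ (j m) = X ^ j / (1 - X ^ j) ^ 2`, rewritten in characteristic `3`. -/
noncomputable def lambertTerm (j : ℕ) : (ZMod 3)⟦X⟧ := (X ^ j - X ^ (2 * j)) * (1 - X ^ (3 * j))⁻¹

theorem hasSum_lambertTerm {j : ℕ} (hj : j ≠ 0) :
    HasSum (fun m : ℕ => (m : (ZMod 3)⟦X⟧) * X ^ (j * m)) (lambertTerm j) := by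
  have hs : Summable fun m : ℕ => (m : (ZMod 3)⟦X⟧) * X ^ (j * m) := by
    refine summable_of_X_pow_dvd (fun m => j * m) (fun B => (Set.finite_le_nat B).subset ?_)
      fun m => Dvd.intro_left _ rfl
    intro m hm
    exact (Nat.le_mul_of_pos_left m (Nat.pos_of_ne_zero hj)).trans hm
  have h := hs.sum_add_tsum_nat_add 3
  have h3 := ZMod.three_eq_zero_powerSeries
  have h' : ∀ m : ℕ, ((m + 3 : ℕ) : (ZMod 3)⟦X⟧) * X ^ (j * (m + 3)) =
      X ^ (3 * j) * ((m : (ZMod 3)⟦X⟧) * X ^ (j * m)) := fun m => by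
    push_cast
    rw [h3]
    ring
  rw [tsum_congr h', hs.tsum_mul_left] at h
  convert hs.hasSum using 1
  set S := ∑' m : ℕ, (m : (ZMod 3)⟦X⟧) * X ^ (j * m)
  simp only [Finset.sum_range_succ, Finset.sum_range_zero] at h
  have hi := one_sub_X_pow_mul_inv (n := 3 * j) (by omega)
  rw [lambertTerm]
  push_cast at h
  linear_combination (1 - X ^ (3 * j))⁻¹ * h + S * hi - (1 - X ^ (3 * j))⁻¹ * X ^ (2 * j) * h3

namespace Overpartition

/-- The partial theta function `∑ (-1) ^ (j - 1) X ^ (j ^ 2 + j m)`, the sum being over `j ≥ 1`. -/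
noncomputable def partialTheta (m : ℕ) : (ZMod 3)⟦X⟧ :=
  ∑' j : ℕ, (-1) ^ j * X ^ ((j + 1) ^ 2 + (j + 1) * m)

theorem summable_partialTheta (m : ℕ) :
    Summable fun j : ℕ => ((-1) ^ j * X ^ ((j + 1) ^ 2 + (j + 1) * m) : (ZMod 3)⟦X⟧) := by
  refine summable_of_X_pow_dvd (fun j => (j + 1) ^ 2 + (j + 1) * m)
    (fun B => (Set.finite_le_nat B).subset fun j hj => ?_) fun j => Dvd.intro_left _ rfl
  simp only [Set.mem_ofPred_eq] at hj ⊢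
  nlinarith

theorem partialTheta_add (m : ℕ) :
    partialTheta m + X ^ (m + 1) * partialTheta (m + 2) = X ^ (m + 1) := by
  have h := (summable_partialTheta m).tsum_eq_zero_add
  have h' : ∀ j : ℕ, ((-1) ^ (j + 1) * X ^ ((j + 1 + 1) ^ 2 + (j + 1 + 1) * m) : (ZMod 3)⟦X⟧) =
      -X ^ (m + 1) * ((-1) ^ j * X ^ ((j + 1) ^ 2 + (j + 1) * (m + 2))) := fun j => by
    ring
  rw [tsum_congr h', (summable_partialTheta _).tsum_mul_left, ← partialTheta,
    ← partialTheta] at h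
  rw [h]
  ring

/-- Both sides satisfy the recursion of Dyson's adjoint relation, which determines the coefficients
from the lower ones. -/
theorem rankTail_eq {m : ℕ} (hm : 0 < m) :
    rankTail (ZMod 3) m = 2 * genFun (ZMod 3) * partialTheta m := by
  have hrec : ∀ m, 0 < m → rankTail (ZMod 3) m - 2 * genFun (ZMod 3) * partialTheta m =
      -(X ^ (m + 1) * (rankTail (ZMod 3) (m + 2) - 2 * genFun (ZMod 3) * partialTheta (m + 2))) :=
    fun m hm => by
      linear_combination rankTail_add (R := ZMod 3) m hm -
        2 * genFun (ZMod 3) * partialTheta_add m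
  have key : ∀ n m, 0 < m →
      coeff n (rankTail (ZMod 3) m - 2 * genFun (ZMod 3) * partialTheta m) = 0 := by
    intro n
    induction n using Nat.strong_induction_on with
    | _ n ih =>
      intro m hm
      rw [hrec m hm, map_neg, coeff_X_pow_mul']
      split_ifs with h
      · rw [ih _ (by omega) _ (by omega), neg_zero]
      · exact neg_zero
  rw [← sub_eq_zero]
  ext n
  rw [key n m hm, map_zero]

/-- The second moment of the positive ranks is a weighted sum over the tails. -/
theorem hasSum_rankTail :
    HasSum (fun m : ℕ => (m : (ZMod 3)⟦X⟧) * rankTail (ZMod 3) m)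
      (statGenFun fun l a => (((l - a) ^ 2 : ℕ) : ZMod 3)) := by
  rw [WithPiTopology.hasSum_iff_hasSum_coeff]
  intro n
  have h0 : ∀ m : ℕ, coeff n ((m : (ZMod 3)⟦X⟧) * rankTail (ZMod 3) m) =
      ∑ π : Overpartition n, (m : ZMod 3) * ((if π.numParts + m ≤ π.largestPart then 1 else 0) +
        if π.numParts + m + 1 ≤ π.largestPart then 1 else 0) := fun m => by
    rw [← map_natCast (C (R := ZMod 3)), coeff_C_mul, rankTail, statGenFun, coeff_mk,
      Finset.mul_sum]
  simp only [h0]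
  rw [statGenFun, coeff_mk]
  refine hasSum_sum fun π _ => ?_
  generalize π.largestPart = l
  generalize π.numParts = a
  have hsum : ∀ t : ℕ,
      ∑ m ∈ Finset.range (t + 1), m * (1 + if m + 1 ≤ t then 1 else 0) = t ^ 2 := by
    intro t
    rw [Finset.sum_range_succ, if_neg (by omega)]
    have h1 : ∀ m ∈ Finset.range t, m * (1 + if m + 1 ≤ t then 1 else 0) = m * 2 := fun m hm => by
      rw [if_pos (show m + 1 ≤ t from Finset.mem_range.1 hm)]
    rw [Finset.sum_congr rfl h1, ← Finset.sum_mul, Finset.sum_range_id_mul_two]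
    rcases t with _ | t
    · rfl
    · rw [Nat.add_sub_cancel]
      ring
  have hval : (((l - a) ^ 2 : ℕ) : ZMod 3) = ∑ m ∈ Finset.range (l - a + 1), (m : ZMod 3) *
      ((if a + m ≤ l then 1 else 0) + if a + m + 1 ≤ l then 1 else 0) := by
    rw [← hsum]
    push_cast
    refine Finset.sum_congr rfl fun m hm => ?_
    rw [Finset.mem_range] at hm
    rcases eq_or_ne m 0 with rfl | hm0
    · simp
    · congr 2
      · rw [if_pos (by omega)]
      · exact if_congr (by omega) rfl rfl
  rw [hval]
  refine hasSum_sum_of_ne_finset_zero fun m hm => ?_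
  rw [Finset.mem_range] at hm
  rcases eq_or_ne m 0 with rfl | hm0
  · simp
  · rw [if_neg (by omega), if_neg (by omega), add_zero, mul_zero]

/-- The Appell–Lerch sum `∑ (-1) ^ j X ^ (j ^ 2 + j) / (1 - X ^ j) ^ 2` over `j ≥ 1`. -/
noncomputable def appellSum : (ZMod 3)⟦X⟧ :=
  ∑' j : ℕ, (-1) ^ (j + 1) * X ^ ((j + 1) ^ 2) * lambertTerm (j + 1)

theorem tsum_mul_partialTheta :
    ∑' m : ℕ, (m : (ZMod 3)⟦X⟧) * partialTheta m = -appellSum := by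
  have hs : Summable (Function.uncurry fun m j : ℕ =>
      (m : (ZMod 3)⟦X⟧) * ((-1) ^ j * X ^ ((j + 1) ^ 2 + (j + 1) * m))) := by
    refine summable_of_X_pow_dvd (fun p => (p.2 + 1) ^ 2 + (p.2 + 1) * p.1) (fun B =>
      ((Set.finite_le_nat B).prod (Set.finite_le_nat B)).subset fun p hp => ?_)
      fun p => ⟨p.1 * (-1) ^ p.2, by simp only [Function.uncurry]; ring⟩
    simp only [Set.mem_ofPred_eq, Set.mem_prod] at hp ⊢
    constructor <;> nlinarith
  have h1 : ∀ m : ℕ, (m : (ZMod 3)⟦X⟧) * partialTheta m =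
      ∑' j : ℕ, (m : (ZMod 3)⟦X⟧) * ((-1) ^ j * X ^ ((j + 1) ^ 2 + (j + 1) * m)) := fun m => by
    rw [partialTheta, (summable_partialTheta m).tsum_mul_left]
  have h2 : ∀ j : ℕ, HasSum
      (fun m : ℕ => (m : (ZMod 3)⟦X⟧) * ((-1) ^ j * X ^ ((j + 1) ^ 2 + (j + 1) * m)))
      (-((-1) ^ (j + 1) * X ^ ((j + 1) ^ 2) * lambertTerm (j + 1))) := fun j => by
    have e : (-((-1) ^ (j + 1) * X ^ ((j + 1) ^ 2) * lambertTerm (j + 1)) : (ZMod 3)⟦X⟧) =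
        (-1) ^ j * X ^ ((j + 1) ^ 2) * lambertTerm (j + 1) := by ring
    have e' : (fun m : ℕ => (m : (ZMod 3)⟦X⟧) * ((-1) ^ j * X ^ ((j + 1) ^ 2 + (j + 1) * m))) =
        fun m : ℕ => (-1) ^ j * X ^ ((j + 1) ^ 2) * ((m : (ZMod 3)⟦X⟧) * X ^ ((j + 1) * m)) :=
      funext fun m => by ring
    rw [e, e']
    exact (hasSum_lambertTerm j.succ_ne_zero).mul_left _
  rw [tsum_congr h1, ← hs.tsum_comm' (fun m => (summable_partialTheta m).mul_left _)
    (fun j => (h2 j).summable), tsum_congr fun j => (h2 j).tsum_eq, tsum_neg, appellSum]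

theorem summable_mul_partialTheta :
    Summable fun m : ℕ => (m : (ZMod 3)⟦X⟧) * partialTheta m := by
  refine summable_of_X_pow_dvd (fun m => m) Set.finite_le_nat fun m => Dvd.dvd.mul_left ?_ _
  rw [X_pow_dvd_iff]
  intro n hn
  rw [partialTheta, (summable_partialTheta m).map_tsum _ (WithPiTopology.continuous_coeff _ n)]
  refine (tsum_congr fun j => ?_).trans tsum_zero
  refine X_pow_dvd_iff.1 (Dvd.intro_left _ rfl) n (hn.trans_le ?_)
  nlinarith

/-- The mixed moment of the largest part and the number of parts. -/
theorem statGenFun_mul :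
    statGenFun (fun l a => (l * a : ZMod 3)) =
      statGenFun (fun _ a => (a ^ 2 : ZMod 3)) - genFun (ZMod 3) * appellSum := by
  have h3 := ZMod.three_eq_zero_powerSeries
  have hpos : statGenFun (fun l a => (((l - a) ^ 2 : ℕ) : ZMod 3)) =
      genFun (ZMod 3) * appellSum := by
    have h : ∀ m : ℕ, (m : (ZMod 3)⟦X⟧) * rankTail (ZMod 3) m =
        2 * genFun (ZMod 3) * ((m : (ZMod 3)⟦X⟧) * partialTheta m) := fun m => by
      rcases Nat.eq_zero_or_pos m with rfl | hm
      · simp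
      · rw [rankTail_eq hm]
        ring
    rw [← hasSum_rankTail.tsum_eq, tsum_congr h, summable_mul_partialTheta.tsum_mul_left,
      tsum_mul_partialTheta]
    linear_combination -(genFun (ZMod 3) * appellSum) * h3
  have hsq : statGenFun (fun l _ => (l ^ 2 : ZMod 3)) = statGenFun fun _ a => (a ^ 2 : ZMod 3) :=
    statGenFun_swap _
  -- `(l - a) ^ 2` is the sum of the contributions of the positive and of the negative ranks,
  -- which agree by conjugation
  have hsplit : statGenFun (fun l a => (l * a : ZMod 3)) =
      C (2 : ZMod 3) * (statGenFun (fun l _ => (l ^ 2 : ZMod 3)) +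
          statGenFun (fun _ a => (a ^ 2 : ZMod 3)) -
        (statGenFun (fun l a => (((l - a) ^ 2 : ℕ) : ZMod 3)) +
          statGenFun (fun l a => (((a - l) ^ 2 : ℕ) : ZMod 3)))) := by
    rw [← statGenFun_add, ← statGenFun_add, ← statGenFun_sub, ← statGenFun_const_mul]
    congr 1
    funext l a
    have h3' : (3 : ZMod 3) = 0 := rfl
    rcases le_total l a with h | h
    · obtain ⟨d, rfl⟩ := Nat.exists_eq_add_of_le h
      rw [Nat.sub_eq_zero_of_le h, Nat.add_sub_cancel_left]
      push_cast
      linear_combination (-(l * (l + d)) : ZMod 3) * h3'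
    · obtain ⟨d, rfl⟩ := Nat.exists_eq_add_of_le h
      rw [Nat.sub_eq_zero_of_le h, Nat.add_sub_cancel_left]
      push_cast
      linear_combination (-(a * (a + d)) : ZMod 3) * h3'
  rw [hsplit, hsq, statGenFun_swap (fun l a => (((a - l) ^ 2 : ℕ) : ZMod 3)), hpos,
    show (C (2 : ZMod 3)) = (2 : (ZMod 3)⟦X⟧) from map_ofNat _ 2]
  linear_combination (statGenFun (fun _ a => (a ^ 2 : ZMod 3)) -
    genFun (ZMod 3) * appellSum) * h3

end Overpartition

/-! ### The Euler operator and Lambert series -/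

/-- The Euler operator `X d/dX`. -/
noncomputable def eulerDeriv : Derivation (ZMod 3) (ZMod 3)⟦X⟧ (ZMod 3)⟦X⟧ :=
  (X : (ZMod 3)⟦X⟧) • derivative (ZMod 3)

theorem coeff_eulerDeriv (f : (ZMod 3)⟦X⟧) (n : ℕ) :
    coeff n (eulerDeriv f) = n * coeff n f := by
  change coeff n (X * derivative (ZMod 3) f) = _
  rcases n with _ | n
  · simp
  · rw [coeff_succ_X_mul, coeff_derivative]
    push_cast
    ring

theorem eulerDeriv_mul (f g : (ZMod 3)⟦X⟧) :
    eulerDeriv (f * g) = f * eulerDeriv g + g * eulerDeriv f := by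
  simp [Derivation.leibniz]

theorem eulerDeriv_one : eulerDeriv 1 = 0 := Derivation.map_one_eq_zero _

theorem eulerDeriv_X_pow (n : ℕ) :
    eulerDeriv (X ^ n : (ZMod 3)⟦X⟧) = (n : (ZMod 3)⟦X⟧) * X ^ n := by
  ext m
  rw [coeff_eulerDeriv, ← map_natCast (C (R := ZMod 3)), coeff_C_mul, coeff_X_pow]
  split_ifs with h
  · rw [h]
  · simp

theorem continuous_eulerDeriv : Continuous eulerDeriv := by
  rw [continuous_iff_continuousAt]
  intro f
  rw [ContinuousAt, WithPiTopology.tendsto_iff_coeff_tendsto]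
  intro n
  simp only [coeff_eulerDeriv]
  exact ((WithPiTopology.continuous_coeff _ n).tendsto f).const_mul _

/-- The series `X ^ n / (1 - X ^ n)`. -/
noncomputable def geomTerm (n : ℕ) : (ZMod 3)⟦X⟧ := X ^ n * (1 - X ^ n)⁻¹

theorem summable_of_X_pow_succ_dvd {f : ℕ → (ZMod 3)⟦X⟧} (h : ∀ i, X ^ i ∣ f i) :
    Summable fun i => f (i + 1) :=
  summable_of_X_pow_dvd (fun i => i) Set.finite_le_nat fun i =>
    (pow_dvd_pow _ i.le_succ).trans (h (i + 1))

theorem X_pow_dvd_geomTerm {s : ℕ} (hs : s ≠ 0) (n : ℕ) :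
    (X : (ZMod 3)⟦X⟧) ^ n ∣ geomTerm (s * n) :=
  (pow_dvd_pow _ (Nat.le_mul_of_pos_left n (Nat.pos_of_ne_zero hs))).trans (Dvd.intro _ rfl)

theorem X_pow_dvd_lambertTerm {s : ℕ} (hs : s ≠ 0) (n : ℕ) :
    (X : (ZMod 3)⟦X⟧) ^ n ∣ lambertTerm (s * n) := by
  have h : n ≤ s * n := Nat.le_mul_of_pos_left n (Nat.pos_of_ne_zero hs)
  exact ((dvd_sub (pow_dvd_pow _ h) (pow_dvd_pow _ (by omega)))).mul_right _

theorem X_pow_dvd_geomTerm_self (n : ℕ) : (X : (ZMod 3)⟦X⟧) ^ n ∣ geomTerm n := by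
  simpa using X_pow_dvd_geomTerm one_ne_zero n

theorem X_pow_dvd_lambertTerm_self (n : ℕ) : (X : (ZMod 3)⟦X⟧) ^ n ∣ lambertTerm n := by
  simpa using X_pow_dvd_lambertTerm one_ne_zero n

theorem lambertTerm_eq {n : ℕ} (hn : n ≠ 0) :
    lambertTerm n = X ^ n * (1 - X ^ n)⁻¹ ^ 2 := by
  have h1 := one_sub_X_pow_mul_inv hn
  have h2 := one_sub_X_pow_mul_inv (n := 3 * n) (by omega)
  have h3 := ZMod.three_eq_zero_powerSeries
  rw [lambertTerm]
  have e1 : (X : (ZMod 3)⟦X⟧) ^ (3 * n) = (X ^ n) ^ 3 := by rw [← pow_mul, mul_comm]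
  have e2 : (X : (ZMod 3)⟦X⟧) ^ (2 * n) = (X ^ n) ^ 2 := by rw [← pow_mul, mul_comm]
  rw [e1] at h2 ⊢
  rw [e2]
  generalize (1 - X ^ n : (ZMod 3)⟦X⟧)⁻¹ = g at *
  generalize (1 - (X ^ n) ^ 3 : (ZMod 3)⟦X⟧)⁻¹ = k at *
  generalize (X : (ZMod 3)⟦X⟧) ^ n = q at *
  have h4 : (1 - q) ^ 3 * k = 1 := by linear_combination h2 - (q - q ^ 2) * k * h3
  have h5 : (1 - q) * k = g ^ 2 := by
    linear_combination -k * (1 - q) * (1 + (1 - q) * g) * h1 + g ^ 2 * h4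
  linear_combination q * h5

/-- Separating the terms of odd and of even index. -/
theorem tsum_odd_index {f : ℕ → (ZMod 3)⟦X⟧} (h : ∀ i, X ^ i ∣ f i) :
    ∑' i : ℕ, (((i + 1) % 2 : ℕ) : (ZMod 3)⟦X⟧) * f (i + 1) =
      ∑' i : ℕ, f (i + 1) - ∑' i : ℕ, f (2 * (i + 1)) := by
  set g : ℕ → (ZMod 3)⟦X⟧ := fun i => (1 - ((i % 2 : ℕ) : (ZMod 3)⟦X⟧)) * f i with hg
  have hgs : Summable fun i => g (i + 1) :=
    summable_of_X_pow_succ_dvd fun i => (h i).mul_left _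
  have hos : Summable fun i : ℕ => (((i + 1) % 2 : ℕ) : (ZMod 3)⟦X⟧) * f (i + 1) :=
    summable_of_X_pow_succ_dvd (f := fun i => ((i % 2 : ℕ) : (ZMod 3)⟦X⟧) * f i)
      fun i => (h i).mul_left _
  have h1 : ∑' i : ℕ, f (i + 1) =
      ∑' i : ℕ, (((i + 1) % 2 : ℕ) : (ZMod 3)⟦X⟧) * f (i + 1) + ∑' i : ℕ, g (i + 1) := by
    rw [← hos.tsum_add hgs]
    refine tsum_congr fun i => ?_
    rw [hg]
    ring
  have h2 : ∑' i : ℕ, g (i + 1) = ∑' i : ℕ, f (2 * (i + 1)) := by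
    have hge : Summable fun k => g (2 * k + 1) :=
      summable_of_X_pow_dvd (fun k => k) Set.finite_le_nat fun k =>
        (pow_dvd_pow _ (by omega)).trans ((h (2 * k + 1)).mul_left _)
    have hgo : Summable fun k => g (2 * k + 1 + 1) :=
      summable_of_X_pow_dvd (fun k => k) Set.finite_le_nat fun k =>
        (pow_dvd_pow _ (by omega)).trans ((h (2 * k + 1 + 1)).mul_left _)
    rw [← tsum_even_add_odd (f := fun i => g (i + 1)) hge hgo]
    have h3 : ∀ k, g (2 * k + 1) = 0 := fun k => by
      have : (2 * k + 1) % 2 = 1 := by omega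
      simp [hg, this]
    have h4 : ∀ k, g (2 * k + 1 + 1) = f (2 * (k + 1)) := fun k => by
      have : (2 * k + 1 + 1) % 2 = 0 := by omega
      simp only [hg, this, Nat.cast_zero, sub_zero, one_mul]
      rfl
    rw [tsum_congr h3, tsum_congr h4, tsum_zero, zero_add]
  rw [h1, h2, add_sub_cancel_right]

/-- The generating function `∑ σ(n) X ^ (s n)` of the sums of divisors, as a Lambert series. -/
noncomputable def sigmaSeries (s : ℕ) : (ZMod 3)⟦X⟧ := ∑' i : ℕ, lambertTerm (s * (i + 1))

theorem hasSum_geomTerm {n : ℕ} (hn : n ≠ 0) :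
    HasSum (fun i : ℕ => (X : (ZMod 3)⟦X⟧) ^ (n * (i + 1))) (geomTerm n) := by
  have hs : Summable fun i : ℕ => (X : (ZMod 3)⟦X⟧) ^ (n * (i + 1)) :=
    summable_of_X_pow_succ_dvd (f := fun i => X ^ (n * i))
      fun i => pow_dvd_pow _ (Nat.le_mul_of_pos_left i (Nat.pos_of_ne_zero hn))
  have h := hs.tsum_eq_zero_add
  have h' : ∀ i : ℕ, (X : (ZMod 3)⟦X⟧) ^ (n * (i + 1 + 1)) = X ^ n * X ^ (n * (i + 1)) :=
    fun i => by ring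
  rw [tsum_congr h', hs.tsum_mul_left] at h
  convert hs.hasSum using 1
  rw [geomTerm]
  have hi := one_sub_X_pow_mul_inv hn
  simp only [zero_add, mul_one] at h
  linear_combination (-(1 - X ^ n)⁻¹) * h + (∑' i : ℕ, (X : (ZMod 3)⟦X⟧) ^ (n * (i + 1))) * hi

theorem hasSum_lambertTerm_succ {n : ℕ} (hn : n ≠ 0) :
    HasSum (fun i : ℕ => ((i + 1 : ℕ) : (ZMod 3)⟦X⟧) * X ^ (n * (i + 1))) (lambertTerm n) := by
  have h := (hasSum_nat_add_iff' 1).2 (hasSum_lambertTerm hn)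
  simpa using h

theorem sigmaSeries_eq {s : ℕ} (hs : s ≠ 0) :
    sigmaSeries s = ∑' i : ℕ, ((i + 1 : ℕ) : (ZMod 3)⟦X⟧) * geomTerm (s * (i + 1)) := by
  have hsum : Summable (Function.uncurry fun i j : ℕ =>
      ((i + 1 : ℕ) : (ZMod 3)⟦X⟧) * X ^ (s * (j + 1) * (i + 1))) := by
    refine summable_of_X_pow_dvd (fun p => s * (p.2 + 1) * (p.1 + 1)) (fun B =>
      ((Set.finite_le_nat B).prod (Set.finite_le_nat B)).subset fun p hp => ?_)
      fun p => Dvd.intro_left _ rfl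
    simp only [Set.mem_ofPred_eq, Set.mem_prod] at hp ⊢
    have : 1 ≤ s := Nat.pos_of_ne_zero hs
    have h1 : (p.2 + 1) * (p.1 + 1) ≤ s * (p.2 + 1) * (p.1 + 1) := by
      rw [mul_assoc]
      exact Nat.le_mul_of_pos_left _ this
    constructor <;> nlinarith
  have h1 : ∀ j, HasSum (fun i : ℕ => ((i + 1 : ℕ) : (ZMod 3)⟦X⟧) * X ^ (s * (j + 1) * (i + 1)))
      (lambertTerm (s * (j + 1))) := fun j =>
    hasSum_lambertTerm_succ (Nat.mul_ne_zero hs j.succ_ne_zero)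
  have h2 : ∀ i, HasSum (fun j : ℕ => ((i + 1 : ℕ) : (ZMod 3)⟦X⟧) * X ^ (s * (j + 1) * (i + 1)))
      (((i + 1 : ℕ) : (ZMod 3)⟦X⟧) * geomTerm (s * (i + 1))) := fun i => by
    have h := (hasSum_geomTerm (Nat.mul_ne_zero hs i.succ_ne_zero)).mul_left
      (((i + 1 : ℕ) : (ZMod 3)⟦X⟧))
    have e : (fun j : ℕ => ((i + 1 : ℕ) : (ZMod 3)⟦X⟧) * X ^ (s * (j + 1) * (i + 1))) =
        fun j : ℕ => ((i + 1 : ℕ) : (ZMod 3)⟦X⟧) * X ^ (s * (i + 1) * (j + 1)) :=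
      funext fun j => by rw [mul_right_comm]
    rw [e]
    exact h
  rw [sigmaSeries, ← tsum_congr fun j => (h1 j).tsum_eq, ← tsum_congr fun i => (h2 i).tsum_eq]
  exact hsum.tsum_comm' (fun i => (h2 i).summable) fun j => (h1 j).summable

/-! ### Logarithmic derivatives of the product formula -/

/-- The logarithmic derivative at `x = 1` of `(1 + x X ^ i) / (1 - x X ^ i)`. -/
noncomputable def partsTerm (i : ℕ) : (ZMod 3)⟦X⟧ := 2 * (geomTerm i - geomTerm (2 * i))

/-- The logarithmic derivative at `y = 1` of `(1 + y X ^ i) / (1 - y ^ (1 + i % 2) X ^ i)`. -/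
noncomputable def partsAddOddTerm (i : ℕ) : (ZMod 3)⟦X⟧ :=
  partsTerm i + ((i % 2 : ℕ) : (ZMod 3)⟦X⟧) * geomTerm i

/-- The mixed logarithmic derivative at `x = y = 1` of
`(1 + x y X ^ i) / (1 - x y ^ (1 + i % 2) X ^ i)`. -/
noncomputable def mixedTerm (i : ℕ) : (ZMod 3)⟦X⟧ :=
  lambertTerm i - 4 * lambertTerm (2 * i) + (1 + ((i % 2 : ℕ) : (ZMod 3)⟦X⟧)) * lambertTerm i

/-- The inverses `g` of `1 - X ^ i` and `h` of `1 + X ^ i`, in terms of which all local terms are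
polynomials. -/
theorem exists_inverses {i : ℕ} (hi : i ≠ 0) : ∃ g h : (ZMod 3)⟦X⟧,
    g * (1 - X ^ i) = 1 ∧ h * (1 + X ^ i) = 1 ∧ geomTerm i = g - 1 ∧ partsTerm i = g - h ∧
      lambertTerm i = (g - 1) * g ∧ lambertTerm i - 4 * lambertTerm (2 * i) = (1 - h) * h := by
  have h1 := one_sub_X_pow_mul_inv hi
  have h2 := one_sub_X_pow_mul_inv (n := 2 * i) (by omega)
  have e : (X : (ZMod 3)⟦X⟧) ^ (2 * i) = (X ^ i) ^ 2 := by rw [← pow_mul, mul_comm]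
  refine ⟨(1 - X ^ i)⁻¹, (1 - X ^ i) * (1 - X ^ (2 * i))⁻¹, ?_⟩
  rw [partsTerm, lambertTerm_eq hi, lambertTerm_eq (n := 2 * i) (by omega), geomTerm, geomTerm]
  rw [e] at h2 ⊢
  generalize (1 - X ^ i : (ZMod 3)⟦X⟧)⁻¹ = g at *
  generalize (1 - (X ^ i) ^ 2 : (ZMod 3)⟦X⟧)⁻¹ = k at *
  generalize (X : (ZMod 3)⟦X⟧) ^ i = q at *
  have hg : g = (1 + q) * k := by linear_combination (1 + q) * k * h1 - g * h2
  subst hg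
  refine ⟨by linear_combination h1, by linear_combination h2, by linear_combination -h1, ?_, ?_, ?_⟩
  · linear_combination (0 : (ZMod 3)⟦X⟧) * h2
  · linear_combination (-(1 + q) * k) * h1
  · linear_combination ((1 - q) * k) * h2

namespace Overpartition

/-- Linearity of `boundedGenFun`, in the shape in which the weights of a new part expand. -/
theorem boundedGenFun_combination {N : ℕ} {R : Type*} [CommRing R] (c : ℕ)
    (f₁ f₂ f₃ f₄ : ℕ → ℕ → R) :
    boundedGenFun N (fun a b => f₁ a b + (1 + (c : R)) * f₂ a b + f₃ a b + (1 + (c : R)) * f₄ a b) =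
      boundedGenFun N f₁ + (1 + (c : R⟦X⟧)) * boundedGenFun N f₂ + boundedGenFun N f₃ +
        (1 + (c : R⟦X⟧)) * boundedGenFun N f₄ := by
  have hc : (1 + (c : R⟦X⟧)) = C (1 + (c : R)) := by simp
  rw [hc]
  generalize 1 + (c : R) = t
  ext n
  simp only [map_add, coeff_C_mul, boundedGenFun, coeff_mk, Finset.mul_sum,
    Finset.sum_add_distrib]

theorem boundedGenFun_zero_fun {N : ℕ} {R : Type*} [CommRing R] :
    boundedGenFun N (fun _ _ => (0 : R)) = 0 := by
  ext n
  simp [boundedGenFun]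

/-- Generating function of the overpartitions with all parts at most `N`. -/
noncomputable def boundedCount (N : ℕ) : (ZMod 3)⟦X⟧ := boundedGenFun N fun _ _ => 1

theorem boundedCount_zero : boundedCount 0 = 1 := by
  rw [boundedCount, boundedGenFun_zero, map_one]

theorem boundedCount_succ (N : ℕ) :
    boundedCount (N + 1) =
      boundedCount N + X ^ (N + 1) * boundedCount N + X ^ (N + 1) * boundedCount (N + 1) :=
  boundedGenFun_succ N _

/-- The first moment of `n(π)`: the derivative at `x = 1` of the product of the
`(1 + x X ^ i) / (1 - x X ^ i)`. -/
theorem boundedGenFun_parts (N : ℕ) :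
    boundedGenFun N (fun a _ => (a : ZMod 3)) =
      boundedCount N * ∑ i ∈ Finset.range N, partsTerm (i + 1) := by
  induction N with
  | zero => simp [boundedGenFun_zero]
  | succ N ih =>
    have hA := boundedCount_succ N
    have hB := boundedGenFun_succ N (fun a _ => (a : ZMod 3))
    have hr : ∀ M, boundedGenFun M (fun a _ => ((a + 1 : ℕ) : ZMod 3)) =
        boundedGenFun M (fun a _ => (a : ZMod 3)) + boundedCount M := fun M => by
      simpa [boundedGenFun_zero_fun, boundedCount] using
        boundedGenFun_combination (N := M) (R := ZMod 3) 0 (fun a _ => a) (fun _ _ => 1)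
          (fun _ _ => 0) fun _ _ => 0
    rw [hr, hr, ih] at hB
    obtain ⟨g, h, hg, hh, -, hs, -, -⟩ := exists_inverses N.succ_ne_zero
    rw [Finset.sum_range_succ, hs]
    rw [Nat.succ_eq_add_one] at hg hh
    generalize (X : (ZMod 3)⟦X⟧) ^ (N + 1) = q at *
    grind

/-- The first moment of `n(π) + n(π_o)`. -/
theorem boundedGenFun_parts_add_odd (N : ℕ) :
    boundedGenFun N (fun a b => ((a + b : ℕ) : ZMod 3)) =
      boundedCount N * ∑ i ∈ Finset.range N, partsAddOddTerm (i + 1) := by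
  induction N with
  | zero => simp [boundedGenFun_zero]
  | succ N ih =>
    have hA := boundedCount_succ N
    have hB := boundedGenFun_succ N (fun a b => ((a + b : ℕ) : ZMod 3))
    have hr : ∀ M c, boundedGenFun M (fun a b => ((a + 1 + (b + c) : ℕ) : ZMod 3)) =
        boundedGenFun M (fun a b => ((a + b : ℕ) : ZMod 3)) +
          (1 + (c : (ZMod 3)⟦X⟧)) * boundedCount M := fun M c => by
      have := boundedGenFun_combination (N := M) (R := ZMod 3) c (fun a b => ((a + b : ℕ) : ZMod 3))
        (fun _ _ => 1) (fun _ _ => 0) fun _ _ => 0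
      simp only [boundedGenFun_zero_fun, mul_zero, add_zero, mul_one] at this
      rw [boundedCount, ← this]
      congr 1
      funext a b
      push_cast
      ring
    have hr0 := hr N 0
    simp only [add_zero, Nat.cast_zero, one_mul] at hr0
    rw [hr, hr0, ih] at hB
    obtain ⟨g, h, hg, hh, hp, hs, -, -⟩ := exists_inverses N.succ_ne_zero
    rw [Finset.sum_range_succ, partsAddOddTerm, hs, hp]
    rw [Nat.succ_eq_add_one] at *
    generalize (X : (ZMod 3)⟦X⟧) ^ (N + 1) = q at *
    generalize (((N + 1) % 2 : ℕ) : (ZMod 3)⟦X⟧) = o at *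
    grind

/-- The mixed moment of `n(π)` and `n(π) + n(π_o)`: the mixed second derivative of a product, in
terms of the derivatives of its logarithm. -/
theorem boundedGenFun_mixed (N : ℕ) :
    boundedGenFun N (fun a b => ((a * (a + b) : ℕ) : ZMod 3)) =
      boundedCount N * ((∑ i ∈ Finset.range N, partsTerm (i + 1)) *
        (∑ i ∈ Finset.range N, partsAddOddTerm (i + 1)) +
          ∑ i ∈ Finset.range N, mixedTerm (i + 1)) := by
  induction N with
  | zero => simp [boundedGenFun_zero]
  | succ N ih =>
    have hA := boundedCount_succ N
    have hB := boundedGenFun_parts N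
    have hB' := boundedGenFun_parts (N + 1)
    have hC := boundedGenFun_parts_add_odd N
    have hC' := boundedGenFun_parts_add_odd (N + 1)
    have hD := boundedGenFun_succ N (fun a b => ((a * (a + b) : ℕ) : ZMod 3))
    have hr : ∀ M c, boundedGenFun M (fun a b => (((a + 1) * (a + 1 + (b + c)) : ℕ) : ZMod 3)) =
        boundedGenFun M (fun a b => ((a * (a + b) : ℕ) : ZMod 3)) +
          (1 + (c : (ZMod 3)⟦X⟧)) * boundedGenFun M (fun a _ => (a : ZMod 3)) +
          boundedGenFun M (fun a b => ((a + b : ℕ) : ZMod 3)) +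
          (1 + (c : (ZMod 3)⟦X⟧)) * boundedCount M := fun M c => by
      rw [boundedCount, ← boundedGenFun_combination]
      congr 1
      funext a b
      push_cast
      ring
    have hr0 := hr N 0
    simp only [add_zero, Nat.cast_zero, one_mul] at hr0
    rw [hr, hr0, ih, hB, hB', hC, hC'] at hD
    obtain ⟨g, h, hg, hh, hp, hs, hL, hL'⟩ := exists_inverses N.succ_ne_zero
    rw [Nat.succ_eq_add_one] at *
    have hc : partsAddOddTerm (N + 1) =
        g - h + (((N + 1) % 2 : ℕ) : (ZMod 3)⟦X⟧) * (g - 1) := by rw [partsAddOddTerm, hs, hp]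
    have hm : mixedTerm (N + 1) =
        (1 - h) * h + (1 + (((N + 1) % 2 : ℕ) : (ZMod 3)⟦X⟧)) * ((g - 1) * g) := by
      rw [mixedTerm, hL', hL]
    simp only [Finset.sum_range_succ, hs, hc, hm] at hD ⊢
    have hgh : 2 * g * h = g + h := by linear_combination g * hh + h * hg
    have hA' : boundedCount N = boundedCount (N + 1) * (2 * h - 1) := by
      linear_combination -h * hA - (boundedCount N + boundedCount (N + 1)) * hh
    have hq : X ^ (N + 1) * g = g - 1 := by linear_combination -hg
    rw [hA'] at hD
    generalize (X : (ZMod 3)⟦X⟧) ^ (N + 1) = q at *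
    generalize (((N + 1) % 2 : ℕ) : (ZMod 3)⟦X⟧) = o at *
    generalize boundedGenFun (N + 1) (fun a b => ((a * (a + b) : ℕ) : ZMod 3)) = D at *
    generalize boundedCount (N + 1) = A at *
    generalize ∑ i ∈ Finset.range N, partsTerm (i + 1) = S at *
    generalize ∑ i ∈ Finset.range N, mixedTerm (i + 1) = W at *
    generalize ∑ i ∈ Finset.range N, partsAddOddTerm (i + 1) = T at *
    have key : (2 * g - 1) * (A * (2 * h - 1) * (S * T + W)) +
        (g - 1) * (A * (2 * h - 1) * S + A * (2 * h - 1) * T + A * (2 * h - 1) +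
          (1 + o) * (A * (S + (g - h))) + A * (T + (g - h + o * (g - 1))) + (1 + o) * A) =
        A * ((S + (g - h)) * (T + (g - h + o * (g - 1))) +
          (W + ((1 - h) * h + (1 + o) * ((g - 1) * g)))) := by
      linear_combination (A * (2 * (S * T + W) + (S + T + 1))) * hgh
    linear_combination key + g * hD - D * hg +
      (A * (2 * h - 1) * (S * T + W) + A * (2 * h - 1) * S + A * (2 * h - 1) * T +
        A * (2 * h - 1) + (1 + o) * (A * (S + (g - h))) + A * (T + (g - h + o * (g - 1))) +
        (1 + o) * A) * hq

theorem eulerDeriv_boundedCount (N : ℕ) :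
    eulerDeriv (boundedCount N) =
      boundedCount N * ∑ i ∈ Finset.range N, ((i + 1 : ℕ) : (ZMod 3)⟦X⟧) * partsTerm (i + 1) := by
  induction N with
  | zero => rw [boundedCount_zero, eulerDeriv_one]; simp
  | succ N ih =>
    have hA := boundedCount_succ N
    have hB := congrArg eulerDeriv hA
    rw [map_add, map_add, eulerDeriv_mul, eulerDeriv_mul, eulerDeriv_X_pow, ih] at hB
    obtain ⟨g, h, hg, hh, -, hs, -, -⟩ := exists_inverses N.succ_ne_zero
    rw [Finset.sum_range_succ, hs]
    rw [Nat.succ_eq_add_one] at hg hh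
    generalize (X : (ZMod 3)⟦X⟧) ^ (N + 1) = q at *
    generalize ((N + 1 : ℕ) : (ZMod 3)⟦X⟧) = m at *
    generalize ∑ i ∈ Finset.range N, ((i + 1 : ℕ) : (ZMod 3)⟦X⟧) * partsTerm (i + 1) = S at *
    generalize eulerDeriv (boundedCount (N + 1)) = D at *
    clear ih
    generalize boundedCount (N + 1) = A at *
    generalize boundedCount N = B at *
    grind

theorem tendsto_boundedGenFun (f : ℕ → ℕ → ZMod 3) :
    Filter.Tendsto (fun N => boundedGenFun N f) Filter.atTop
      (nhds (PowerSeries.mk fun n => ∑ π : Overpartition n, f π.numParts π.numOddPlain)) := by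
  rw [WithPiTopology.tendsto_iff_coeff_tendsto]
  intro n
  refine tendsto_const_nhds.congr' ?_
  filter_upwards [Filter.eventually_ge_atTop n] with N hN
  rw [boundedGenFun, coeff_mk, coeff_mk, Finset.filter_true_of_mem]
  exact fun π _ => π.largestPart_le.trans hN

theorem tendsto_boundedCount :
    Filter.Tendsto boundedCount Filter.atTop (nhds (genFun (ZMod 3))) :=
  tendsto_boundedGenFun fun _ _ => 1

theorem summable_partsTerm : Summable fun i => partsTerm (i + 1) :=
  summable_of_X_pow_succ_dvd fun i => Dvd.dvd.mul_left
    (dvd_sub (X_pow_dvd_geomTerm_self i) (X_pow_dvd_geomTerm two_ne_zero i)) _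

/-- In characteristic `3` the first moment of `n(π) + n(π_o)` vanishes, so that the mixed moment
reduces to a single Lambert series. -/
theorem tsum_partsAddOddTerm : ∑' i, partsAddOddTerm (i + 1) = 0 := by
  have h1 : Summable fun i => geomTerm (i + 1) :=
    summable_of_X_pow_succ_dvd X_pow_dvd_geomTerm_self
  have h2 : Summable fun i => geomTerm (2 * (i + 1)) :=
    summable_of_X_pow_succ_dvd (f := fun i => geomTerm (2 * i)) (X_pow_dvd_geomTerm two_ne_zero)
  have h3 : Summable fun i : ℕ => (((i + 1) % 2 : ℕ) : (ZMod 3)⟦X⟧) * geomTerm (i + 1) :=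
    summable_of_X_pow_succ_dvd (f := fun i => ((i % 2 : ℕ) : (ZMod 3)⟦X⟧) * geomTerm i)
      fun i => (X_pow_dvd_geomTerm_self i).mul_left _
  simp only [partsAddOddTerm, partsTerm]
  rw [((h1.sub h2).mul_left 2).tsum_add h3, (h1.sub h2).tsum_mul_left, h1.tsum_sub h2,
    tsum_odd_index X_pow_dvd_geomTerm_self]
  linear_combination (∑' i, geomTerm (i + 1) - ∑' i, geomTerm (2 * (i + 1))) *
    ZMod.three_eq_zero_powerSeries

theorem summable_lambertTerm_mul {s : ℕ} (hs : s ≠ 0) :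
    Summable fun i => lambertTerm (s * (i + 1)) :=
  summable_of_X_pow_succ_dvd (f := fun i => lambertTerm (s * i)) (X_pow_dvd_lambertTerm hs)

theorem summable_mixedTerm : Summable fun i => mixedTerm (i + 1) :=
  summable_of_X_pow_succ_dvd fun i => (dvd_sub (X_pow_dvd_lambertTerm_self i)
    ((X_pow_dvd_lambertTerm two_ne_zero i).mul_left 4)).add
      ((X_pow_dvd_lambertTerm_self i).mul_left _)

theorem tsum_mixedTerm : ∑' i, mixedTerm (i + 1) = sigmaSeries 2 := by
  have h1 : Summable fun i => lambertTerm (i + 1) :=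
    summable_of_X_pow_succ_dvd X_pow_dvd_lambertTerm_self
  have h2 := summable_lambertTerm_mul two_ne_zero
  have h3 : Summable fun i : ℕ => (((i + 1) % 2 : ℕ) : (ZMod 3)⟦X⟧) * lambertTerm (i + 1) :=
    summable_of_X_pow_succ_dvd (f := fun i => ((i % 2 : ℕ) : (ZMod 3)⟦X⟧) * lambertTerm i)
      fun i => (X_pow_dvd_lambertTerm_self i).mul_left _
  simp only [mixedTerm, add_mul, one_mul]
  rw [(h1.sub (h2.mul_left 4)).tsum_add (h1.add h3), h1.tsum_sub (h2.mul_left 4), h1.tsum_add h3,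
    h2.tsum_mul_left, tsum_odd_index X_pow_dvd_lambertTerm_self, sigmaSeries]
  linear_combination (∑' i, lambertTerm (i + 1) - 2 * ∑' i, lambertTerm (2 * (i + 1))) *
    ZMod.three_eq_zero_powerSeries

/-- The moment `∑ n(π) (n(π) + n(π_o))` has generating function `genFun * sigmaSeries 2`. -/
theorem moment_eq :
    (PowerSeries.mk fun n => ∑ π : Overpartition n,
      ((π.numParts * (π.numParts + π.numOddPlain) : ℕ) : ZMod 3)) =
        genFun (ZMod 3) * sigmaSeries 2 := by
  have h := tendsto_boundedGenFun fun a b => ((a * (a + b) : ℕ) : ZMod 3)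
  simp only [boundedGenFun_mixed] at h
  have hc : Summable fun i => partsAddOddTerm (i + 1) := by
    refine summable_of_X_pow_succ_dvd fun i => ?_
    exact (Dvd.dvd.mul_left (dvd_sub (X_pow_dvd_geomTerm_self i)
      (X_pow_dvd_geomTerm two_ne_zero i)) _).add ((X_pow_dvd_geomTerm_self i).mul_left _)
  have h' := tendsto_boundedCount.mul ((summable_partsTerm.hasSum.tendsto_sum_nat.mul
    hc.hasSum.tendsto_sum_nat).add summable_mixedTerm.hasSum.tendsto_sum_nat)
  rw [tendsto_nhds_unique h h', tsum_partsAddOddTerm, tsum_mixedTerm, mul_zero, zero_add]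

/-- The logarithmic derivative of the product of the `(1 + X ^ i) / (1 - X ^ i)`. -/
theorem eulerDeriv_genFun :
    eulerDeriv (genFun (ZMod 3)) =
      2 * genFun (ZMod 3) * (sigmaSeries 1 - sigmaSeries 2) := by
  have h := (continuous_eulerDeriv.tendsto _).comp tendsto_boundedCount
  simp only [Function.comp_def, eulerDeriv_boundedCount] at h
  have h1 : Summable fun i : ℕ => ((i + 1 : ℕ) : (ZMod 3)⟦X⟧) * geomTerm (1 * (i + 1)) :=
    summable_of_X_pow_succ_dvd (f := fun i => (i : (ZMod 3)⟦X⟧) * geomTerm (1 * i))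
      fun i => (X_pow_dvd_geomTerm one_ne_zero i).mul_left _
  have h2 : Summable fun i : ℕ => ((i + 1 : ℕ) : (ZMod 3)⟦X⟧) * geomTerm (2 * (i + 1)) :=
    summable_of_X_pow_succ_dvd (f := fun i => (i : (ZMod 3)⟦X⟧) * geomTerm (2 * i))
      fun i => (X_pow_dvd_geomTerm two_ne_zero i).mul_left _
  have e : ∀ i : ℕ, ((i + 1 : ℕ) : (ZMod 3)⟦X⟧) * partsTerm (i + 1) =
      2 * (((i + 1 : ℕ) : (ZMod 3)⟦X⟧) * geomTerm (1 * (i + 1)) -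
        ((i + 1 : ℕ) : (ZMod 3)⟦X⟧) * geomTerm (2 * (i + 1))) := fun i => by
    rw [partsTerm, one_mul]
    ring
  simp only [e] at h
  have h' := tendsto_boundedCount.mul ((h1.sub h2).mul_left 2).hasSum.tendsto_sum_nat
  rw [tendsto_nhds_unique h h', (h1.sub h2).tsum_mul_left, h1.tsum_sub h2,
    ← sigmaSeries_eq one_ne_zero, ← sigmaSeries_eq two_ne_zero]
  ring

end Overpartition

/-! ### Appell-type sums at powers of `q` -/

/-- The triangular number `y (y + 1) / 2`, for an arbitrary integer `y`; it is never
negative, so that `toNat` loses nothing. -/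
def triangle (y : ℤ) : ℕ := (y * (y + 1) / 2).toNat

theorem two_mul_triangle (y : ℤ) : 2 * (triangle y : ℤ) = y * (y + 1) := by
  have h : 0 ≤ y * (y + 1) := by
    rcases le_or_gt 0 y with h | h <;> nlinarith
  rw [triangle, Int.toNat_of_nonneg (by omega)]
  exact Int.mul_ediv_cancel' (Int.even_mul_succ_self y).two_dvd

theorem abs_le_of_triangle_le {y : ℤ} {B : ℕ} (h : triangle y ≤ B) : |y| ≤ 2 * B + 1 := by
  have h1 := two_mul_triangle y
  have h2 : (triangle y : ℤ) ≤ B := by exact_mod_cast h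
  rw [abs_le]
  constructor <;> nlinarith [sq_nonneg (y + 1), sq_nonneg y]

/-- The sign `(-1) ^ m` for an integer `m`. -/
noncomputable def intSign (m : ℤ) : (ZMod 3)⟦X⟧ := if Even m then 1 else -1

theorem two_ne_zero_powerSeries : (2 : (ZMod 3)⟦X⟧) ≠ 0 := by
  intro h
  have : (1 : (ZMod 3)⟦X⟧) = 0 := by
    linear_combination ZMod.three_eq_zero_powerSeries - h
  exact one_ne_zero this

/-- An alternating sum vanishes if its exponents are invariant under a reflection that changes the
parity. -/
theorem tsum_intSign_eq_zero (c : ℤ) (F : ℤ → ℕ) (hF : ∀ m, F (-1 - 2 * c - m) = F m) :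
    ∑' m : ℤ, intSign m * X ^ F m = 0 := by
  have h : ∑' m : ℤ, intSign m * X ^ F m = -∑' m : ℤ, intSign m * X ^ F m := by
    rw [← tsum_neg, ← (Equiv.subLeft (-1 - 2 * c)).tsum_eq]
    refine tsum_congr fun m => ?_
    have hp : Even (-1 - 2 * c - m) ↔ ¬ Even m := by
      simp [Int.even_sub, parity_simps]
    rw [Equiv.subLeft_apply, hF]
    simp only [intSign, hp]
    split_ifs <;> simp
  have h2 : (2 : (ZMod 3)⟦X⟧) * ∑' m : ℤ, intSign m * X ^ F m = 0 := by
    linear_combination h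
  exact (mul_eq_zero.1 h2).resolve_left two_ne_zero_powerSeries

theorem summable_of_two_mul_eq {s : ℕ} (hs : s ≠ 0) {A : ℕ} (c : ℤ) {e : ℕ → ℕ}
    (he : ∀ m : ℕ, 2 * (e m : ℤ) = 2 * A + s * (m * (m + 1) + 2 * c * m)) :
    Summable fun m : ℕ => ((-1) ^ (m + 1) * X ^ e (m + 1) : (ZMod 3)⟦X⟧) := by
  refine summable_of_X_pow_dvd (fun m => e (m + 1)) (fun B =>
    (Set.finite_le_nat (2 * B + 2 * c.natAbs)).subset fun m hm => ?_) fun i => Dvd.intro_left _ rfl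
  simp only [Set.mem_ofPred_eq] at hm ⊢
  by_contra! hlt
  have h := he (m + 1)
  have h1 : (1 : ℤ) ≤ s := by exact_mod_cast Nat.pos_of_ne_zero hs
  have h2 : (e (m + 1) : ℤ) ≤ B := by exact_mod_cast hm
  have h3 : -|c| ≤ c := neg_abs_le c
  have h4 : (2 * B + 2 * |c| : ℤ) < m := by
    have : ((2 * B + 2 * c.natAbs : ℕ) : ℤ) < m := by exact_mod_cast hlt
    push_cast at this
    simpa using this
  have h5 : (0 : ℤ) ≤ |c| := abs_nonneg c
  push_cast at h
  have h6 : (m + 1 : ℤ) * (2 * B + 2) ≤ (m + 1) * (m + 1 + 1) + 2 * c * (m + 1) := by nlinarith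
  have h7 : (m + 1 : ℤ) * (2 * B + 2) ≤ s * ((m + 1) * (m + 1 + 1) + 2 * c * (m + 1)) :=
    h6.trans (le_mul_of_one_le_left (le_trans (by positivity) h6) h1)
  nlinarith

/-- The two halves of an alternating theta series that vanishes. -/
theorem tsum_add_tsum_reflect {s : ℕ} (hs : s ≠ 0) {A : ℕ} (c : ℤ) {e e' : ℕ → ℕ}
    (he : ∀ m : ℕ, 2 * (e m : ℤ) = 2 * A + s * (m * (m + 1) + 2 * c * m))
    (he' : ∀ m : ℕ, 2 * (e' m : ℤ) = 2 * A + s * (m * (m + 1) + 2 * (-1 - c) * m)) :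
    ∑' m : ℕ, ((-1) ^ (m + 1) * X ^ e (m + 1) : (ZMod 3)⟦X⟧) +
      ∑' m : ℕ, ((-1) ^ (m + 1) * X ^ e' (m + 1) : (ZMod 3)⟦X⟧) = -X ^ A := by
  set F : ℤ → ℕ := fun m => if 0 ≤ m then e m.toNat else e' (-m).toNat with hFdef
  have hF : ∀ m : ℤ, 2 * (F m : ℤ) = 2 * A + s * (m * (m + 1) + 2 * c * m) := by
    intro m
    rw [hFdef]
    by_cases hm : 0 ≤ m
    · simp only [hm, if_true]
      rw [he, Int.toNat_of_nonneg hm]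
    · simp only [hm, if_false]
      rw [he', Int.toNat_of_nonneg (by omega)]
      ring
  have hz := tsum_intSign_eq_zero c F fun m => by
    have h1 := hF m
    have h2 := hF (-1 - 2 * c - m)
    have : (2 : ℤ) * F (-1 - 2 * c - m) = 2 * F m := by
      rw [h1, h2]
      ring
    omega
  have hs1 := summable_of_two_mul_eq hs c he
  have hs2 := summable_of_two_mul_eq hs (-1 - c) he'
  have hsign : ∀ m : ℕ, intSign m = (-1) ^ m := fun m => by
    rw [intSign]
    split_ifs with h
    · rw [Even.neg_one_pow (by exact_mod_cast h)]
    · rw [Odd.neg_one_pow (by rw [← Nat.not_even_iff_odd]; exact_mod_cast h)]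
  have e1 : ∀ m : ℕ, intSign (m : ℤ) * X ^ F m = (-1) ^ m * X ^ e m := fun m => by
    rw [hsign]
    simp [hFdef]
  have e2 : ∀ m : ℕ, intSign (-((m : ℤ) + 1)) * X ^ F (-((m : ℤ) + 1)) =
      (-1) ^ (m + 1) * X ^ e' (m + 1) := fun m => by
    have : intSign (-((m : ℤ) + 1)) = intSign ((m + 1 : ℕ) : ℤ) := by
      simp only [intSign, even_neg]
      push_cast
      rfl
    rw [this, hsign]
    have h : ¬ (0 : ℤ) ≤ -((m : ℤ) + 1) := by omega
    simp only [hFdef, h, if_false]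
    congr 3
  have hsum1 : Summable fun m : ℕ => ((-1) ^ m * X ^ e m : (ZMod 3)⟦X⟧) :=
    (summable_nat_add_iff 1).1 hs1
  rw [tsum_of_nat_of_neg_add_one (by simpa only [e1] using hsum1) (by simpa only [e2] using hs2),
    tsum_congr e1, tsum_congr e2, hsum1.tsum_eq_zero_add] at hz
  have h0 : e 0 = A := by
    have := he 0
    push_cast at this
    simp at this
    exact this
  rw [h0] at hz
  linear_combination hz

/-- The case of a non-negative power. The quotient is a finite geometric sum, whose terms pair up by
`tsum_add_tsum_reflect`. -/
theorem tsum_alternating_nat (n : ℕ) {A s : ℕ} (hs : s ≠ 0) {e₁ e₂ : ℕ → ℕ}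
    (h₁ : ∀ m : ℕ, 2 * (e₁ m : ℤ) = 2 * A + s * (m * (m + 1) - 2 * n * m))
    (h₂ : ∀ m : ℕ, 2 * (e₂ m : ℤ) = 2 * A + s * (m * (m + 1) + 2 * n * m)) :
    ∑' m : ℕ, ((-1) ^ (m + 1) * (X ^ e₁ (m + 1) - X ^ e₂ (m + 1)) *
      (1 - X ^ (s * (m + 1)))⁻¹ : (ZMod 3)⟦X⟧) = -(n : (ZMod 3)⟦X⟧) * X ^ A := by
  have h21 : ∀ m, e₂ m = e₁ m + s * m * (2 * n) := fun m => by
    have := h₁ m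
    have := h₂ m
    have : (2 : ℤ) * e₂ m = 2 * (e₁ m + s * m * (2 * n) : ℕ) := by
      push_cast
      linarith
    omega
  have hterm : ∀ m : ℕ, ((-1) ^ (m + 1) * (X ^ e₁ (m + 1) - X ^ e₂ (m + 1)) *
      (1 - X ^ (s * (m + 1)))⁻¹ : (ZMod 3)⟦X⟧) =
        ∑ i ∈ Finset.range (2 * n), (-1) ^ (m + 1) * X ^ (e₁ (m + 1) + s * (m + 1) * i) :=
    fun m => by
    have hi := one_sub_X_pow_mul_inv (n := s * (m + 1)) (Nat.mul_ne_zero hs m.succ_ne_zero)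
    have hg := mul_neg_geom_sum ((X : (ZMod 3)⟦X⟧) ^ (s * (m + 1))) (2 * n)
    simp only [pow_add, pow_mul _ (s * (m + 1)), h21, ← Finset.mul_sum]
    rw [← mul_one_sub, ← hg]
    linear_combination (-1) ^ (m + 1) * X ^ e₁ (m + 1) *
      (∑ i ∈ Finset.range (2 * n), ((X : (ZMod 3)⟦X⟧) ^ (s * (m + 1))) ^ i) * hi
  have he : ∀ i m : ℕ, 2 * ((e₁ m + s * m * i : ℕ) : ℤ) =
      2 * A + s * (m * (m + 1) + 2 * ((i : ℤ) - n) * m) := fun i m => by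
    push_cast
    linear_combination h₁ m
  have hsum : ∀ i : ℕ, Summable fun m : ℕ =>
      ((-1) ^ (m + 1) * X ^ (e₁ (m + 1) + s * (m + 1) * i) : (ZMod 3)⟦X⟧) := fun i =>
    summable_of_two_mul_eq hs _ (e := fun m => e₁ m + s * m * i) (he i)
  rw [tsum_congr hterm, Summable.tsum_finsetSum fun i _ => hsum i]
  set f : ℕ → (ZMod 3)⟦X⟧ := fun i =>
    ∑' m : ℕ, (-1) ^ (m + 1) * X ^ (e₁ (m + 1) + s * (m + 1) * i) with hf
  have hpair : ∀ i ∈ Finset.range (2 * n), f i + f (2 * n - 1 - i) = -X ^ A := fun i hi => by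
    refine tsum_add_tsum_reflect hs ((i : ℤ) - n) (e := fun m => e₁ m + s * m * i)
      (e' := fun m => e₁ m + s * m * (2 * n - 1 - i)) (he i) fun m => ?_
    rw [he]
    have := Finset.mem_range.1 hi
    have : ((2 * n - 1 - i : ℕ) : ℤ) = 2 * n - 1 - i := by omega
    rw [this]
    ring
  have h2 : (2 : (ZMod 3)⟦X⟧) * ∑ i ∈ Finset.range (2 * n), f i =
      2 * (-(n : (ZMod 3)⟦X⟧) * X ^ A) := by
    rw [two_mul]
    nth_rewrite 2 [← Finset.sum_range_reflect]
    rw [← Finset.sum_add_distrib, Finset.sum_congr rfl hpair, Finset.sum_const, Finset.card_range,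
      nsmul_eq_mul]
    push_cast
    ring
  exact mul_left_cancel₀ two_ne_zero_powerSeries h2

/-- The evaluation at `z = q ^ N` of the Appell-type sum
`∑ (-1) ^ m q ^ (m (m + 1) / 2) (z ^ (-m) - z ^ m) / (1 - q ^ m)`, for `q = X ^ s`. Both
sides are multiplied by `X ^ A`, which is included in the exponents `e₁` and `e₂`. -/
theorem tsum_alternating (N : ℤ) {A s : ℕ} (hs : s ≠ 0) {e₁ e₂ : ℕ → ℕ}
    (h₁ : ∀ m : ℕ, 2 * (e₁ m : ℤ) = 2 * A + s * (m * (m + 1) - 2 * N * m))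
    (h₂ : ∀ m : ℕ, 2 * (e₂ m : ℤ) = 2 * A + s * (m * (m + 1) + 2 * N * m)) :
    ∑' m : ℕ, ((-1) ^ (m + 1) * (X ^ e₁ (m + 1) - X ^ e₂ (m + 1)) *
      (1 - X ^ (s * (m + 1)))⁻¹ : (ZMod 3)⟦X⟧) = -(N : (ZMod 3)⟦X⟧) * X ^ A := by
  obtain ⟨n, rfl | rfl⟩ := N.eq_nat_or_neg
  · simpa using tsum_alternating_nat n hs h₁ h₂
  · have h := tsum_alternating_nat n hs (e₁ := e₂) (e₂ := e₁)
      (fun m => by rw [h₂]; ring) (fun m => by rw [h₁]; ring)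
    have hneg : ∀ m : ℕ, ((-1) ^ (m + 1) * (X ^ e₁ (m + 1) - X ^ e₂ (m + 1)) *
        (1 - X ^ (s * (m + 1)))⁻¹ : (ZMod 3)⟦X⟧) =
          -((-1) ^ (m + 1) * (X ^ e₂ (m + 1) - X ^ e₁ (m + 1)) *
            (1 - X ^ (s * (m + 1)))⁻¹) := fun m => by ring
    rw [tsum_congr hneg, tsum_neg, h]
    push_cast
    ring

/-! ### Theta series by residues modulo `3` -/

/-- The sum of `X ^ (y (y + 1) / 2)` over the integers `y` congruent to `r` modulo `3`. -/
noncomputable def thetaSeries (r : ℤ) : (ZMod 3)⟦X⟧ := ∑' N : ℤ, X ^ triangle (3 * N + r)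

/-- The weighted sum of `N X ^ (3 N (3 N + 1) / 2)` over all integers `N`. -/
noncomputable def weightedTheta : (ZMod 3)⟦X⟧ :=
  ∑' N : ℤ, (N : (ZMod 3)⟦X⟧) * X ^ triangle (3 * N)

theorem finite_abs_le (B : ℤ) : {N : ℤ | |N| ≤ B}.Finite :=
  (Set.finite_Icc (-B) B).subset fun _ h => abs_le.1 h

theorem summable_thetaSeries (r : ℤ) :
    Summable fun N : ℤ => (X ^ triangle (3 * N + r) : (ZMod 3)⟦X⟧) := by
  refine summable_of_X_pow_dvd (fun N => triangle (3 * N + r)) (fun B =>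
    (finite_abs_le (2 * B + 1 + |r|)).subset fun N hN => ?_) fun _ => dvd_rfl
  have h := abs_le_of_triangle_le hN
  rw [Set.mem_ofPred_eq]
  rw [abs_le] at h ⊢
  have := neg_abs_le r
  have := le_abs_self r
  constructor <;> omega

theorem thetaSeries_add_three (r : ℤ) : thetaSeries (r + 3) = thetaSeries r := by
  rw [thetaSeries, thetaSeries, ← (Equiv.addRight (1 : ℤ)).tsum_eq
    fun N : ℤ => (X ^ triangle (3 * N + r) : (ZMod 3)⟦X⟧)]
  refine tsum_congr fun N => ?_
  rw [Equiv.coe_addRight]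
  ring_nf

theorem triangle_reflect (y : ℤ) : triangle (-1 - y) = triangle y := by
  have h1 := two_mul_triangle y
  have h2 := two_mul_triangle (-1 - y)
  have : (-1 - y) * (-1 - y + 1) = y * (y + 1) := by ring
  omega

theorem thetaSeries_reflect (r : ℤ) : thetaSeries (-1 - r) = thetaSeries r := by
  rw [thetaSeries, thetaSeries, ← (Equiv.neg ℤ).tsum_eq
    fun N : ℤ => (X ^ triangle (3 * N + r) : (ZMod 3)⟦X⟧)]
  refine tsum_congr fun N => ?_
  rw [Equiv.neg_apply, ← triangle_reflect]
  ring_nf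

theorem thetaSeries_add_three_mul (r k : ℤ) : thetaSeries (r + 3 * k) = thetaSeries r := by
  induction k with
  | zero => simp
  | succ k ih => rw [mul_add, mul_one, ← add_assoc, thetaSeries_add_three, ih]
  | pred k ih =>
    rw [← thetaSeries_add_three, ← ih]
    congr 1
    ring

theorem thetaSeries_eq_of_emod (r : ℤ) :
    thetaSeries r = if r % 3 = 1 then thetaSeries 1 else thetaSeries 0 := by
  rw [← Int.emod_add_mul_ediv r 3, thetaSeries_add_three_mul]
  have h0 := Int.emod_nonneg r (by norm_num : (3 : ℤ) ≠ 0)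
  have h1 := Int.emod_lt_of_pos r (by norm_num : (0 : ℤ) < 3)
  have h2 : thetaSeries 2 = thetaSeries 0 := by
    have h := (thetaSeries_add_three (-1 - 0)).trans (thetaSeries_reflect 0)
    norm_num at h
    exact h
  interval_cases r % 3 <;> simp [h2]

theorem summable_mul_X_pow_triangle (c : ℕ → (ZMod 3)⟦X⟧) (hc : ∀ m, X ^ m ∣ c m) (r : ℕ → ℤ)
    (hr : ∀ m, |r m| ≤ 3 * m) :
    Summable fun p : ℤ × ℕ => c (p.2 + 1) * X ^ triangle (3 * p.1 + r (p.2 + 1)) := by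
  refine summable_of_X_pow_dvd
    (fun p => p.2 + 1 + triangle (3 * p.1 + r (p.2 + 1))) (fun B =>
    ((finite_abs_le (5 * B + 1)).prod (Set.finite_le_nat B)).subset fun p hp => ?_) fun p => ?_
  · obtain ⟨N, m⟩ := p
    simp only [Set.mem_ofPred_eq, Set.mem_prod] at hp ⊢
    have h1 : triangle (3 * N + r (m + 1)) ≤ B := by omega
    have h2 := abs_le_of_triangle_le h1
    have h3 := hr (m + 1)
    rw [abs_le] at h2 h3 ⊢
    push_cast at h3
    refine ⟨⟨?_, ?_⟩, ?_⟩ <;> omega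
  · rw [pow_add]
    exact mul_dvd_mul_right (hc _) _

/-- Summing `tsum_alternating` over all `N`, with the order of summation exchanged. -/
theorem tsum_alternating_thetaSeries {s : ℕ} (hs : s ≠ 0) {p₁ p₂ : ℕ → ℕ} {r₁ r₂ : ℕ → ℤ}
    (hp₁ : ∀ m, m ≤ p₁ m) (hp₂ : ∀ m, m ≤ p₂ m)
    (hr₁ : ∀ m, |r₁ m| ≤ 3 * m) (hr₂ : ∀ m, |r₂ m| ≤ 3 * m)
    (h₁ : ∀ (N : ℤ) (m : ℕ), 2 * (p₁ m + triangle (3 * N + r₁ m) : ℤ) =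
      2 * triangle (3 * N) + s * (m * (m + 1) - 2 * N * m))
    (h₂ : ∀ (N : ℤ) (m : ℕ), 2 * (p₂ m + triangle (3 * N + r₂ m) : ℤ) =
      2 * triangle (3 * N) + s * (m * (m + 1) + 2 * N * m)) :
    ∑' m : ℕ, (-1) ^ (m + 1) * (X ^ p₁ (m + 1) * thetaSeries (r₁ (m + 1)) -
      X ^ p₂ (m + 1) * thetaSeries (r₂ (m + 1))) * (1 - X ^ (s * (m + 1)))⁻¹ =
        -weightedTheta := by
  set c₁ : ℕ → (ZMod 3)⟦X⟧ := fun m => (-1) ^ m * X ^ p₁ m * (1 - X ^ (s * m))⁻¹ with hc₁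
  set c₂ : ℕ → (ZMod 3)⟦X⟧ := fun m => (-1) ^ m * X ^ p₂ m * (1 - X ^ (s * m))⁻¹ with hc₂
  have hd₁ : ∀ m, X ^ m ∣ c₁ m := fun m => ((pow_dvd_pow _ (hp₁ m)).mul_left _).mul_right _
  have hd₂ : ∀ m, X ^ m ∣ c₂ m := fun m => ((pow_dvd_pow _ (hp₂ m)).mul_left _).mul_right _
  have hsum : Summable (Function.uncurry fun (N : ℤ) (m : ℕ) =>
      c₁ (m + 1) * X ^ triangle (3 * N + r₁ (m + 1)) -
        c₂ (m + 1) * X ^ triangle (3 * N + r₂ (m + 1))) :=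
    (summable_mul_X_pow_triangle c₁ hd₁ r₁ hr₁).sub (summable_mul_X_pow_triangle c₂ hd₂ r₂ hr₂)
  have hrow : ∀ N : ℤ, ∑' m : ℕ, (c₁ (m + 1) * X ^ triangle (3 * N + r₁ (m + 1)) -
      c₂ (m + 1) * X ^ triangle (3 * N + r₂ (m + 1))) =
        -(N : (ZMod 3)⟦X⟧) * X ^ triangle (3 * N) := fun N => by
    rw [← tsum_alternating N hs (A := triangle (3 * N))
      (e₁ := fun m => p₁ m + triangle (3 * N + r₁ m))
      (e₂ := fun m => p₂ m + triangle (3 * N + r₂ m))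
      (fun m => by push_cast; exact h₁ N m) (fun m => by push_cast; exact h₂ N m)]
    refine tsum_congr fun m => ?_
    simp only [hc₁, hc₂, pow_add]
    ring
  have hcol : ∀ m : ℕ, ∑' N : ℤ, (c₁ (m + 1) * X ^ triangle (3 * N + r₁ (m + 1)) -
      c₂ (m + 1) * X ^ triangle (3 * N + r₂ (m + 1))) =
        (-1) ^ (m + 1) * (X ^ p₁ (m + 1) * thetaSeries (r₁ (m + 1)) -
          X ^ p₂ (m + 1) * thetaSeries (r₂ (m + 1))) * (1 - X ^ (s * (m + 1)))⁻¹ := fun m => by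
    rw [((summable_thetaSeries _).mul_left _).tsum_sub ((summable_thetaSeries _).mul_left _),
      (summable_thetaSeries _).tsum_mul_left, (summable_thetaSeries _).tsum_mul_left,
      ← thetaSeries, ← thetaSeries]
    simp only [hc₁, hc₂]
    ring
  rw [← tsum_congr hcol, weightedTheta, ← tsum_neg]
  simp only [← neg_mul]
  rw [← tsum_congr hrow]
  exact hsum.tsum_comm' (fun N => summable_of_X_pow_succ_dvd
    (f := fun m => c₁ m * X ^ triangle (3 * N + r₁ m) - c₂ m * X ^ triangle (3 * N + r₂ m))
    fun m => dvd_sub ((hd₁ m).mul_right _) ((hd₂ m).mul_right _)) fun m =>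
    ((summable_thetaSeries _).mul_left _).sub ((summable_thetaSeries _).mul_left _)

/-- The terms of `Overpartition.appellSum` whose exponents are divisible by `3`. -/
noncomputable def appellTermZero (m : ℕ) : (ZMod 3)⟦X⟧ :=
  (-1) ^ m * ((if m % 3 = 1 then 0 else X ^ (m ^ 2 + m)) -
    (if m % 3 = 2 then 0 else X ^ (m ^ 2 + 2 * m))) * (1 - X ^ (3 * m))⁻¹

/-- The terms of `Overpartition.appellSum` whose exponents are congruent to `2` modulo `3`. -/
noncomputable def appellTermTwo (m : ℕ) : (ZMod 3)⟦X⟧ :=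
  (-1) ^ m * ((if m % 3 = 1 then X ^ (m ^ 2 + m) else 0) -
    (if m % 3 = 2 then X ^ (m ^ 2 + 2 * m) else 0)) * (1 - X ^ (3 * m))⁻¹

/-- The part of `Overpartition.appellSum` with exponents divisible by `3`. -/
noncomputable def appellZero : (ZMod 3)⟦X⟧ := ∑' i, appellTermZero (i + 1)

/-- The part of `Overpartition.appellSum` with exponents congruent to `2` modulo `3`. -/
noncomputable def appellTwo : (ZMod 3)⟦X⟧ := ∑' i, appellTermTwo (i + 1)

theorem X_pow_dvd_appellTermZero (m : ℕ) : X ^ m ∣ appellTermZero m := by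
  refine ((dvd_sub ?_ ?_).mul_left _).mul_right _
  all_goals split_ifs
  all_goals first | exact dvd_zero _ | exact pow_dvd_pow _ (by omega)

theorem X_pow_dvd_appellTermTwo (m : ℕ) : X ^ m ∣ appellTermTwo m := by
  refine ((dvd_sub ?_ ?_).mul_left _).mul_right _
  all_goals split_ifs
  all_goals first | exact dvd_zero _ | exact pow_dvd_pow _ (by omega)

theorem appellSum_eq : Overpartition.appellSum = appellZero + appellTwo := by
  rw [Overpartition.appellSum, appellZero, appellTwo,
    ← (summable_of_X_pow_succ_dvd X_pow_dvd_appellTermZero).tsum_add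
      (summable_of_X_pow_succ_dvd X_pow_dvd_appellTermTwo)]
  refine tsum_congr fun j => ?_
  rw [appellTermZero, appellTermTwo, lambertTerm, ← add_mul, ← mul_add, ← mul_assoc]
  congr 1
  rw [mul_assoc]
  congr 1
  split_ifs <;> first | omega | ring

theorem eulerDeriv_neg_one_pow (m : ℕ) : eulerDeriv ((-1) ^ m) = 0 := by
  rcases neg_one_pow_eq_or (ZMod 3)⟦X⟧ m with h | h <;> simp [h]

theorem eulerDeriv_one_sub_X_pow_inv {m : ℕ} (hm : m ≠ 0) :
    eulerDeriv (1 - X ^ (3 * m))⁻¹ = 0 := by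
  have h := one_sub_X_pow_mul_inv (n := 3 * m) (by omega)
  have h' := congrArg eulerDeriv h
  rw [eulerDeriv_mul, map_sub, eulerDeriv_one, eulerDeriv_X_pow] at h'
  push_cast at h'
  have h3 := ZMod.three_eq_zero_powerSeries
  linear_combination (1 - X ^ (3 * m))⁻¹ * h' - eulerDeriv (1 - X ^ (3 * m))⁻¹ * h +
    (1 - X ^ (3 * m))⁻¹ ^ 2 * m * X ^ (3 * m) * h3

theorem natCast_eq_zero_powerSeries {n : ℕ} (h : n % 3 = 0) : (n : (ZMod 3)⟦X⟧) = 0 := by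
  obtain ⟨k, rfl⟩ := Nat.dvd_of_mod_eq_zero h
  push_cast
  rw [ZMod.three_eq_zero_powerSeries, zero_mul]

theorem natCast_eq_two_powerSeries {n : ℕ} (h : n % 3 = 2) : (n : (ZMod 3)⟦X⟧) = 2 := by
  rw [← Nat.mod_add_div n 3, h]
  push_cast
  rw [ZMod.three_eq_zero_powerSeries, zero_mul, add_zero]

theorem eulerDeriv_appellTermZero {m : ℕ} (hm : m ≠ 0) : eulerDeriv (appellTermZero m) = 0 := by
  have h1 : m % 3 ≠ 1 → (m ^ 2 + m) % 3 = 0 := fun h => by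
    have : m % 3 = 0 ∨ m % 3 = 2 := by omega
    rcases this with h | h <;> simp [Nat.add_mod, Nat.pow_mod, h]
  have h2 : m % 3 ≠ 2 → (m ^ 2 + 2 * m) % 3 = 0 := fun h => by
    have : m % 3 = 0 ∨ m % 3 = 1 := by omega
    rcases this with h | h <;> simp [Nat.add_mod, Nat.pow_mod, Nat.mul_mod, h]
  rw [appellTermZero, eulerDeriv_mul, eulerDeriv_mul, eulerDeriv_one_sub_X_pow_inv hm,
    eulerDeriv_neg_one_pow, map_sub]
  have e1 : eulerDeriv (if m % 3 = 1 then 0 else X ^ (m ^ 2 + m)) = 0 := by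
    split_ifs with h
    · exact map_zero _
    · rw [eulerDeriv_X_pow, natCast_eq_zero_powerSeries (h1 h), zero_mul]
  have e2 : eulerDeriv (if m % 3 = 2 then 0 else X ^ (m ^ 2 + 2 * m)) = 0 := by
    split_ifs with h
    · exact map_zero _
    · rw [eulerDeriv_X_pow, natCast_eq_zero_powerSeries (h2 h), zero_mul]
  rw [e1, e2]
  ring

theorem eulerDeriv_appellTermTwo {m : ℕ} (hm : m ≠ 0) :
    eulerDeriv (appellTermTwo m) = 2 * appellTermTwo m := by
  have h1 : m % 3 = 1 → (m ^ 2 + m) % 3 = 2 := fun h => by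
    simp [Nat.add_mod, Nat.pow_mod, h]
  have h2 : m % 3 = 2 → (m ^ 2 + 2 * m) % 3 = 2 := fun h => by
    simp [Nat.add_mod, Nat.pow_mod, Nat.mul_mod, h]
  rw [appellTermTwo, eulerDeriv_mul, eulerDeriv_mul, eulerDeriv_one_sub_X_pow_inv hm,
    eulerDeriv_neg_one_pow, map_sub]
  have e1 : eulerDeriv (if m % 3 = 1 then X ^ (m ^ 2 + m) else 0) =
      2 * if m % 3 = 1 then X ^ (m ^ 2 + m) else 0 := by
    split_ifs with h
    · rw [eulerDeriv_X_pow, natCast_eq_two_powerSeries (h1 h)]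
    · rw [map_zero, mul_zero]
  have e2 : eulerDeriv (if m % 3 = 2 then X ^ (m ^ 2 + 2 * m) else 0) =
      2 * if m % 3 = 2 then X ^ (m ^ 2 + 2 * m) else 0 := by
    split_ifs with h
    · rw [eulerDeriv_X_pow, natCast_eq_two_powerSeries (h2 h)]
    · rw [map_zero, mul_zero]
  rw [e1, e2]
  ring

theorem eulerDeriv_tsum {ι : Type*} {f : ι → (ZMod 3)⟦X⟧} (hf : Summable f) :
    eulerDeriv (∑' i, f i) = ∑' i, eulerDeriv (f i) :=
  hf.map_tsum eulerDeriv continuous_eulerDeriv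

theorem eulerDeriv_appellZero : eulerDeriv appellZero = 0 := by
  rw [appellZero, eulerDeriv_tsum (summable_of_X_pow_succ_dvd X_pow_dvd_appellTermZero)]
  simp [eulerDeriv_appellTermZero]

theorem eulerDeriv_appellTwo : eulerDeriv appellTwo = 2 * appellTwo := by
  have h := summable_of_X_pow_succ_dvd X_pow_dvd_appellTermTwo
  rw [appellTwo, eulerDeriv_tsum h, ← h.tsum_mul_left]
  exact tsum_congr fun m => eulerDeriv_appellTermTwo m.succ_ne_zero

/-- The evaluation at the powers of `X ^ 3`. The two residue parts of the Appell–Lerch sum meet the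
two theta series. -/
theorem thetaSeries_mul_appell :
    thetaSeries 0 * appellZero + thetaSeries 1 * appellTwo = weightedTheta := by
  have h := tsum_alternating_thetaSeries (s := 3) (by norm_num)
    (p₁ := fun m => m ^ 2 + 2 * m) (p₂ := fun m => m ^ 2 + m)
    (r₁ := fun m => -m) (r₂ := fun m => m) (fun m => by nlinarith) (fun m => by nlinarith)
    (fun m => by rw [abs_neg, Nat.abs_cast]; omega) (fun m => by rw [Nat.abs_cast]; omega)
    (fun N m => by
      rw [mul_add, two_mul_triangle, two_mul_triangle]
      push_cast
      ring)
    (fun N m => by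
      rw [mul_add, two_mul_triangle, two_mul_triangle]
      push_cast
      ring)
  have h0 := summable_of_X_pow_succ_dvd X_pow_dvd_appellTermZero
  have h2 := summable_of_X_pow_succ_dvd X_pow_dvd_appellTermTwo
  rw [appellZero, appellTwo, ← h0.tsum_mul_left, ← h2.tsum_mul_left,
    ← (h0.mul_left _).tsum_add (h2.mul_left _), ← neg_neg weightedTheta, ← h, ← tsum_neg]
  refine tsum_congr fun m => ?_
  rw [appellTermZero, appellTermTwo, thetaSeries_eq_of_emod (-((m + 1 : ℕ) : ℤ)),
    thetaSeries_eq_of_emod ((m + 1 : ℕ) : ℤ)]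
  have e1 : -((m + 1 : ℕ) : ℤ) % 3 = 1 ↔ (m + 1) % 3 = 2 := by omega
  have e2 : ((m + 1 : ℕ) : ℤ) % 3 = 1 ↔ (m + 1) % 3 = 1 := by omega
  simp only [e1, e2]
  split_ifs <;> ring

/-- The evaluation at the powers of `X ^ 9`, where only the theta series of residue `0` occurs. -/
theorem thetaSeries_mul_sigmaSeries :
    thetaSeries 0 * -(sigmaSeries 3 + sigmaSeries 6) = weightedTheta := by
  have h := tsum_alternating_thetaSeries (s := 9) (by norm_num)
    (p₁ := fun m => 6 * m) (p₂ := fun m => 3 * m)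
    (r₁ := fun m => 3 * -(m : ℤ)) (r₂ := fun m => 3 * m) (fun m => by omega) (fun m => by omega)
    (fun m => by rw [abs_mul, abs_neg, Nat.abs_cast]; norm_num)
    (fun m => by rw [abs_mul, Nat.abs_cast]; norm_num)
    (fun N m => by
      rw [mul_add, two_mul_triangle, two_mul_triangle]
      push_cast
      ring)
    (fun N m => by
      rw [mul_add, two_mul_triangle, two_mul_triangle]
      push_cast
      ring)
  have ht : ∀ k : ℤ, thetaSeries (3 * k) = thetaSeries 0 := fun k => by
    simpa using thetaSeries_add_three_mul 0 k
  simp only [ht] at h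
  have h3 := Overpartition.summable_lambertTerm_mul three_ne_zero
  have ho : Summable fun i : ℕ => (((i + 1) % 2 : ℕ) : (ZMod 3)⟦X⟧) * lambertTerm (3 * (i + 1)) :=
    summable_of_X_pow_succ_dvd (f := fun i => ((i % 2 : ℕ) : (ZMod 3)⟦X⟧) * lambertTerm (3 * i))
      fun i => (X_pow_dvd_lambertTerm three_ne_zero i).mul_left _
  have hodd := tsum_odd_index (f := fun i => lambertTerm (3 * i))
    (X_pow_dvd_lambertTerm three_ne_zero)
  have e : ∀ m : ℕ, ((-1) ^ (m + 1) * (X ^ (6 * (m + 1)) * thetaSeries 0 -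
      X ^ (3 * (m + 1)) * thetaSeries 0) * (1 - X ^ (9 * (m + 1)))⁻¹ : (ZMod 3)⟦X⟧) =
        -thetaSeries 0 * (lambertTerm (3 * (m + 1)) -
          2 * ((((m + 1) % 2 : ℕ) : (ZMod 3)⟦X⟧) * lambertTerm (3 * (m + 1)))) := fun m => by
    rw [lambertTerm, show 2 * (3 * (m + 1)) = 6 * (m + 1) by ring,
      show 3 * (3 * (m + 1)) = 9 * (m + 1) by ring]
    rcases Nat.even_or_odd (m + 1) with h | h
    · rw [h.neg_one_pow, Nat.even_iff.1 h]
      push_cast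
      ring
    · rw [h.neg_one_pow, Nat.odd_iff.1 h]
      push_cast
      ring
  have e' : ∀ i, lambertTerm (3 * (2 * (i + 1))) = lambertTerm (6 * (i + 1)) := fun i => by
    congr 1
    ring
  rw [tsum_congr e, (h3.sub (ho.mul_left 2)).tsum_mul_left, h3.tsum_sub (ho.mul_left 2),
    ho.tsum_mul_left, hodd, tsum_congr e', ← sigmaSeries, ← sigmaSeries] at h
  linear_combination -h - thetaSeries 0 * sigmaSeries 6 * ZMod.three_eq_zero_powerSeries

/-! ### Gauss's identity for triangular numbers -/

/-- The factor `(1 - X ^ (2 k + 2)) / (1 - X ^ (2 k + 1))` of Gauss's product. -/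
noncomputable def gaussFactor (k : ℕ) : (ZMod 3)⟦X⟧ :=
  (1 - X ^ (2 * k + 2)) * (1 - X ^ (2 * k + 1))⁻¹

/-- The product of the factors of index `s, …, n - 1`. -/
noncomputable def gaussProd (s n : ℕ) : (ZMod 3)⟦X⟧ := ∏ k ∈ Finset.Ico s n, gaussFactor k

/-- Telescoping in Shanks's finite form of Gauss's identity. -/
theorem sum_gaussProd_sub (n j : ℕ) (hj : j ≤ n) :
    ∑ s ∈ Finset.range j,
      (gaussProd s (n + 1) * X ^ (s * (2 * n + 3)) - gaussProd s n * X ^ (s * (2 * n + 1))) =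
        gaussProd j n * (1 - X ^ (2 * j)) * (1 - X ^ (2 * n + 1))⁻¹ * X ^ (j * (2 * n + 1)) := by
  induction j with
  | zero => simp
  | succ s ih =>
    rw [Finset.sum_range_succ, ih (by omega)]
    have h1 : gaussProd s n = gaussFactor s * gaussProd (s + 1) n :=
      Finset.prod_eq_prod_Ico_succ_bot (by omega) _
    have h2 : gaussProd s (n + 1) = gaussProd s n * gaussFactor n :=
      Finset.prod_Ico_succ_top (by omega) _
    have e1 := one_sub_X_pow_mul_inv (n := 2 * n + 1) (by omega)
    have e2 := one_sub_X_pow_mul_inv (n := 2 * s + 1) (by omega)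
    rw [h2, h1, gaussFactor, gaussFactor]
    have p1 : (X : (ZMod 3)⟦X⟧) ^ (s * (2 * n + 3)) =
      X ^ (s * (2 * n + 1)) * X ^ (2 * s) := by ring
    have p2 : (X : (ZMod 3)⟦X⟧) ^ ((s + 1) * (2 * n + 1)) =
      X ^ (s * (2 * n + 1)) * X ^ (2 * n + 1) := by ring
    have p3 : (X : (ZMod 3)⟦X⟧) ^ (2 * n + 2) = X ^ (2 * n + 1) * X := by ring
    have p4 : (X : (ZMod 3)⟦X⟧) ^ (2 * s + 1) = X ^ (2 * s) * X := by ring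
    rw [p1, p2, p3]
    rw [p4] at e2 ⊢
    rw [show 2 * (s + 1) = 2 * s + 2 by ring]
    generalize (1 - X ^ (2 * n + 1) : (ZMod 3)⟦X⟧)⁻¹ = h at *
    generalize (1 - X ^ (2 * s) * X : (ZMod 3)⟦X⟧)⁻¹ = ρ at *
    generalize (X : (ZMod 3)⟦X⟧) ^ (2 * n + 1) = x at *
    generalize (X : (ZMod 3)⟦X⟧) ^ (2 * s) = q at *
    generalize (X : (ZMod 3)⟦X⟧) ^ (s * (2 * n + 1)) = Q at *
    generalize (X : (ZMod 3)⟦X⟧) ^ (2 * s + 2) = t at *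
    linear_combination gaussProd (s + 1) n * (1 - t) * Q * (x * h * e2 + ρ * e1)

/-- Shanks's finite form of Gauss's identity for the sum of `X ^ (t (t + 1) / 2)`. -/
theorem sum_gaussProd (n : ℕ) :
    ∑ s ∈ Finset.range n, gaussProd s n * X ^ (s * (2 * n + 1)) =
      ∑ t ∈ Finset.range (2 * n), (X : (ZMod 3)⟦X⟧) ^ triangle t := by
  induction n with
  | zero => simp
  | succ n ih =>
    have h := sum_gaussProd_sub n n le_rfl
    rw [Finset.sum_sub_distrib, ih] at h
    have t1 : triangle ((2 * n : ℕ) : ℤ) = n * (2 * n + 1) := by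
      have := two_mul_triangle ((2 * n : ℕ) : ℤ)
      zify
      push_cast at this ⊢
      linarith
    have t2 : triangle ((2 * n + 1 : ℕ) : ℤ) = n * (2 * n + 1) + (2 * n + 1) := by
      have := two_mul_triangle ((2 * n + 1 : ℕ) : ℤ)
      zify
      push_cast at this ⊢
      linarith
    have h2 : gaussProd n (n + 1) = gaussFactor n := by
      rw [gaussProd, Nat.Ico_succ_singleton, Finset.prod_singleton]
    have h3 : gaussProd n n = 1 := by rw [gaussProd, Finset.Ico_self, Finset.prod_empty]
    have e1 := one_sub_X_pow_mul_inv (n := 2 * n + 1) (by omega)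
    rw [Finset.sum_range_succ, show 2 * (n + 1) + 1 = 2 * n + 3 by ring,
      show 2 * (n + 1) = 2 * n + 1 + 1 by ring, Finset.sum_range_succ, Finset.sum_range_succ, t1,
      t2,
      h2, gaussFactor]
    rw [h3] at h
    have p1 : (X : (ZMod 3)⟦X⟧) ^ (n * (2 * n + 3)) =
      X ^ (n * (2 * n + 1)) * X ^ (2 * n) := by ring
    have p2 : (X : (ZMod 3)⟦X⟧) ^ (2 * n + 2) * X ^ (2 * n) =
        X ^ (2 * n + 1) * X ^ (2 * n + 1) := by
      ring
    rw [p1, pow_add X (n * (2 * n + 1))]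
    linear_combination h + X ^ (n * (2 * n + 1)) * (1 + X ^ (2 * n + 1)) * e1 -
      X ^ (n * (2 * n + 1)) * (1 - X ^ (2 * n + 1))⁻¹ * p2

/-- The generating function of the triangular numbers. -/
noncomputable def psiSeries : (ZMod 3)⟦X⟧ := ∑' t : ℕ, X ^ triangle t

theorem summable_triangle : Summable fun y : ℤ => (X : (ZMod 3)⟦X⟧) ^ triangle y :=
  summable_of_X_pow_dvd triangle
    (fun B => (finite_abs_le (2 * B + 1)).subset fun _ h => abs_le_of_triangle_le h)
    fun _ => dvd_rfl

theorem summable_triangle_nat : Summable fun t : ℕ => (X : (ZMod 3)⟦X⟧) ^ triangle t :=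
  summable_of_X_pow_dvd (fun t : ℕ => triangle t)
    (fun B => (Set.finite_le_nat (2 * B + 1)).subset fun t h => by
      have := abs_le_of_triangle_le h
      rw [Nat.abs_cast] at this
      rw [Set.mem_ofPred_eq]
      omega) fun _ => dvd_rfl

theorem tendsto_gaussProd :
    Filter.Tendsto (gaussProd 0) Filter.atTop (nhds psiSeries) := by
  have h : Filter.Tendsto (fun n => ∑ t ∈ Finset.range (2 * n), (X : (ZMod 3)⟦X⟧) ^ triangle t)
      Filter.atTop (nhds psiSeries) :=
    summable_triangle_nat.hasSum.tendsto_sum_nat.comp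
      (Filter.tendsto_id.const_mul_atTop' two_pos)
  rw [WithPiTopology.tendsto_iff_coeff_tendsto] at h ⊢
  intro d
  refine (h d).congr' ?_
  filter_upwards [Filter.eventually_ge_atTop (d + 1)] with n hn
  rw [← sum_gaussProd, Finset.range_eq_Ico, Finset.sum_eq_sum_Ico_succ_bot (by omega), zero_mul,
    pow_zero, mul_one, map_add, map_sum]
  refine add_eq_left.2 (Finset.sum_eq_zero fun s hs => ?_)
  refine X_pow_dvd_iff.1 (Dvd.intro_left _ rfl) d ?_
  have := (Finset.mem_Ico.1 hs).1
  nlinarith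

theorem eulerDeriv_gaussProd (n : ℕ) :
    eulerDeriv (gaussProd 0 n) = gaussProd 0 n * ∑ k ∈ Finset.range n,
      (((2 * k + 1 : ℕ) : (ZMod 3)⟦X⟧) * geomTerm (2 * k + 1) -
        ((2 * k + 2 : ℕ) : (ZMod 3)⟦X⟧) * geomTerm (2 * k + 2)) := by
  induction n with
  | zero => simp [gaussProd]
  | succ n ih =>
    have h2 : gaussProd 0 (n + 1) = gaussProd 0 n * gaussFactor n :=
      Finset.prod_Ico_succ_top (by omega) _
    have e1 := one_sub_X_pow_mul_inv (n := 2 * n + 1) (by omega)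
    have e2 := one_sub_X_pow_mul_inv (n := 2 * n + 2) (by omega)
    have h' := congrArg eulerDeriv e1
    rw [eulerDeriv_mul, map_sub, eulerDeriv_one, eulerDeriv_X_pow] at h'
    rw [h2, eulerDeriv_mul, ih, Finset.sum_range_succ, gaussFactor, eulerDeriv_mul, map_sub,
      eulerDeriv_one, eulerDeriv_X_pow, geomTerm, geomTerm]
    generalize (1 - X ^ (2 * n + 1) : (ZMod 3)⟦X⟧)⁻¹ = h at *
    generalize (1 - X ^ (2 * n + 2) : (ZMod 3)⟦X⟧)⁻¹ = k at *
    generalize (X : (ZMod 3)⟦X⟧) ^ (2 * n + 1) = x at *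
    generalize (X : (ZMod 3)⟦X⟧) ^ (2 * n + 2) = y at *
    generalize ((2 * n + 1 : ℕ) : (ZMod 3)⟦X⟧) = a at *
    generalize ((2 * n + 2 : ℕ) : (ZMod 3)⟦X⟧) = b at *
    generalize eulerDeriv h = h1 at *
    have hh : h1 = a * x * h ^ 2 := by
      linear_combination h * h' - h1 * e1
    rw [hh]
    linear_combination gaussProd 0 n * b * y * h * e2

/-- The logarithmic derivative of Gauss's product is `E₁ - 4 E₂`, and `4 = 1` in characteristic
`3`. -/
theorem eulerDeriv_psiSeries :
    eulerDeriv psiSeries = psiSeries * (sigmaSeries 1 - sigmaSeries 2) := by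
  have h := (continuous_eulerDeriv.tendsto _).comp tendsto_gaussProd
  simp only [Function.comp_def, eulerDeriv_gaussProd] at h
  have hd : ∀ i : ℕ, X ^ i ∣ (i : (ZMod 3)⟦X⟧) * geomTerm i :=
    fun i => (X_pow_dvd_geomTerm_self i).mul_left _
  have h1 : Summable fun k : ℕ => ((2 * k + 1 : ℕ) : (ZMod 3)⟦X⟧) * geomTerm (2 * k + 1) :=
    summable_of_X_pow_dvd (fun k => k) Set.finite_le_nat fun k =>
      (pow_dvd_pow _ (by omega)).trans (hd (2 * k + 1))
  have h2 : Summable fun k : ℕ => ((2 * k + 2 : ℕ) : (ZMod 3)⟦X⟧) * geomTerm (2 * k + 2) :=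
    summable_of_X_pow_dvd (fun k => k) Set.finite_le_nat fun k =>
      (pow_dvd_pow _ (by omega)).trans (hd (2 * k + 2))
  have h3 : ∑' k : ℕ, ((2 * k + 2 : ℕ) : (ZMod 3)⟦X⟧) * geomTerm (2 * k + 2) =
      2 * sigmaSeries 2 := by
    have hs : Summable fun i : ℕ => ((i + 1 : ℕ) : (ZMod 3)⟦X⟧) * geomTerm (2 * (i + 1)) :=
      summable_of_X_pow_succ_dvd (f := fun i => (i : (ZMod 3)⟦X⟧) * geomTerm (2 * i))
        fun i => (X_pow_dvd_geomTerm two_ne_zero i).mul_left _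
    rw [sigmaSeries_eq two_ne_zero, ← hs.tsum_mul_left]
    refine tsum_congr fun k => ?_
    push_cast
    ring_nf
  have h4 : ∑' k : ℕ, ((2 * k + 1 : ℕ) : (ZMod 3)⟦X⟧) * geomTerm (2 * k + 1) +
      ∑' k : ℕ, ((2 * k + 2 : ℕ) : (ZMod 3)⟦X⟧) * geomTerm (2 * k + 2) = sigmaSeries 1 := by
    rw [sigmaSeries_eq one_ne_zero]
    simp only [one_mul]
    exact tsum_even_add_odd (f := fun i : ℕ => ((i + 1 : ℕ) : (ZMod 3)⟦X⟧) * geomTerm (i + 1)) h1 h2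
  have h' := tendsto_gaussProd.mul (h1.sub h2).hasSum.tendsto_sum_nat
  rw [tendsto_nhds_unique h h', h1.tsum_sub h2]
  linear_combination psiSeries * (h4 - 2 * h3) - psiSeries * sigmaSeries 2 *
    ZMod.three_eq_zero_powerSeries

theorem tsum_X_pow_triangle : ∑' y : ℤ, (X : (ZMod 3)⟦X⟧) ^ triangle y = 2 * psiSeries := by
  have e : ∀ n : ℕ, (X : (ZMod 3)⟦X⟧) ^ triangle (-((n : ℤ) + 1)) = X ^ triangle n := fun n => by
    rw [← triangle_reflect n, neg_add_rev, sub_eq_add_neg]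
  have h : Summable fun n : ℕ => (X : (ZMod 3)⟦X⟧) ^ triangle (-((n : ℤ) + 1)) := by
    simpa only [e] using summable_triangle_nat
  rw [tsum_of_nat_of_neg_add_one (f := fun y : ℤ => (X : (ZMod 3)⟦X⟧) ^ triangle y)
    summable_triangle_nat h, tsum_congr e, ← psiSeries, two_mul]

/-- The triangular numbers, sorted by the residue of the index modulo `3`. -/
theorem two_mul_psiSeries : 2 * psiSeries = 2 * thetaSeries 0 + thetaSeries 1 := by
  have h2 : thetaSeries 2 = thetaSeries 0 := thetaSeries_eq_of_emod 2
  let e : Fin 3 × ℤ ≃ ℤ := (Equiv.prodComm (Fin 3) ℤ).trans (Int.divModEquiv 3).symm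
  have he : ∀ p, e p = 3 * p.2 + (p.1 : ℕ) := fun p => by
    change p.2 * (3 : ℕ) + (p.1 : ℕ) = _
    push_cast
    ring
  have hs := (e.summable_iff (f := fun y : ℤ => (X : (ZMod 3)⟦X⟧) ^ triangle y)).2
    summable_triangle
  rw [← tsum_X_pow_triangle, ← e.tsum_eq]
  simp only [Function.comp_def, he] at hs ⊢
  have h := hs.tsum_prod' fun r => summable_thetaSeries ((r : ℕ) : ℤ)
  refine h.trans ?_
  rw [tsum_fintype, Fin.sum_univ_three]
  have e0 : ∑' N : ℤ, (X : (ZMod 3)⟦X⟧) ^ triangle (3 * N + (((0 : Fin 3) : ℕ) : ℤ)) =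
    thetaSeries 0 := by rw [Fin.val_zero, Nat.cast_zero, thetaSeries]
  have e1 : ∑' N : ℤ, (X : (ZMod 3)⟦X⟧) ^ triangle (3 * N + (((1 : Fin 3) : ℕ) : ℤ)) =
    thetaSeries 1 := by rw [Fin.val_one, Nat.cast_one, thetaSeries]
  have e2 : ∑' N : ℤ, (X : (ZMod 3)⟦X⟧) ^ triangle (3 * N + (((2 : Fin 3) : ℕ) : ℤ)) =
    thetaSeries 0 := by rw [← h2, Fin.val_two, Nat.cast_ofNat, thetaSeries]
  linear_combination e0 + e1 + e2

/-! ### The differential equation modulo `3` -/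

theorem eulerDeriv_lambertTerm {m : ℕ} (hm : m ≠ 0) :
    eulerDeriv (lambertTerm m) = (m : (ZMod 3)⟦X⟧) * (geomTerm m - geomTerm (3 * m)) := by
  have h1 := one_sub_X_pow_mul_inv hm
  have h2 := one_sub_X_pow_mul_inv (n := 3 * m) (by omega)
  have h3 := ZMod.three_eq_zero_powerSeries
  rw [lambertTerm, eulerDeriv_mul, eulerDeriv_one_sub_X_pow_inv hm, map_sub, eulerDeriv_X_pow,
    eulerDeriv_X_pow, geomTerm, geomTerm]
  rw [show (X : (ZMod 3)⟦X⟧) ^ (3 * m) = (X ^ m) ^ 3 by rw [← pow_mul, mul_comm]] at h2 ⊢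
  rw [show (X : (ZMod 3)⟦X⟧) ^ (2 * m) = (X ^ m) ^ 2 by rw [← pow_mul, mul_comm]]
  push_cast
  generalize (1 - X ^ m : (ZMod 3)⟦X⟧)⁻¹ = g at *
  generalize (1 - (X ^ m) ^ 3 : (ZMod 3)⟦X⟧)⁻¹ = k at *
  generalize (X : (ZMod 3)⟦X⟧) ^ m = q at *
  have hg : g = (1 + q + q ^ 2) * k := by linear_combination (1 + q + q ^ 2) * k * h1 - g * h2
  rw [hg]
  linear_combination -(m : (ZMod 3)⟦X⟧) * q ^ 2 * k * h3

/-- For `s = 1` this says `n σ(n) = σ(n) - σ(n / 3)` modulo `3`. -/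
theorem eulerDeriv_sigmaSeries {s : ℕ} (hs : s ≠ 0) :
    eulerDeriv (sigmaSeries s) =
      (s : (ZMod 3)⟦X⟧) * (sigmaSeries s - sigmaSeries (3 * s)) := by
  have h : ∀ t, t ≠ 0 →
      Summable fun i : ℕ => ((i + 1 : ℕ) : (ZMod 3)⟦X⟧) * geomTerm (t * (i + 1)) := fun t ht =>
    summable_of_X_pow_succ_dvd (f := fun i => (i : (ZMod 3)⟦X⟧) * geomTerm (t * i))
      fun i => (X_pow_dvd_geomTerm ht i).mul_left _
  have h1 := h s hs
  have h2 := h (3 * s) (by omega)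
  rw [sigmaSeries_eq hs, sigmaSeries_eq (show 3 * s ≠ 0 by omega), ← h1.tsum_sub h2,
    ← (h1.sub h2).tsum_mul_left, ← sigmaSeries_eq hs, sigmaSeries,
    eulerDeriv_tsum (Overpartition.summable_lambertTerm_mul hs)]
  refine tsum_congr fun i => ?_
  rw [eulerDeriv_lambertTerm (Nat.mul_ne_zero hs i.succ_ne_zero), ← mul_assoc 3]
  push_cast
  ring

theorem eulerDeriv_thetaSeries_zero : eulerDeriv (thetaSeries 0) = 0 := by
  rw [thetaSeries, eulerDeriv_tsum (summable_thetaSeries 0)]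
  refine (tsum_congr fun N => ?_).trans tsum_zero
  have h := two_mul_triangle (3 * N + 0)
  have : (triangle (3 * N + 0)) % 3 = 0 := by
    have : (2 * triangle (3 * N + 0) : ℤ) = 3 * (N * (3 * N + 1)) := by
      rw [h]
      ring
    omega
  rw [eulerDeriv_X_pow, natCast_eq_zero_powerSeries this, zero_mul]

theorem eulerDeriv_thetaSeries_one : eulerDeriv (thetaSeries 1) = thetaSeries 1 := by
  rw [thetaSeries, eulerDeriv_tsum (summable_thetaSeries 1)]
  refine tsum_congr fun N => ?_
  have h := two_mul_triangle (3 * N + 1)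
  have : (triangle (3 * N + 1)) % 3 = 1 := by
    have : (2 * triangle (3 * N + 1) : ℤ) = 3 * (N * (3 * N + 3)) + 2 := by
      rw [h]
      ring
    omega
  rw [eulerDeriv_X_pow, ← Nat.mod_add_div (triangle (3 * N + 1)) 3, this]
  push_cast
  rw [ZMod.three_eq_zero_powerSeries]
  ring

theorem coeff_zero_thetaSeries : coeff 0 (thetaSeries 0) = 1 := by
  rw [thetaSeries, (summable_thetaSeries 0).map_tsum _ (WithPiTopology.continuous_coeff _ 0),
    tsum_eq_single 0]
  · simp [triangle]
  · intro N hN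
    rw [coeff_X_pow, if_neg]
    intro h
    have := two_mul_triangle (3 * N + 0)
    rw [← h] at this
    have h0 : N = 0 ∨ 3 * N + 1 = 0 := by
      have : N * (3 * N + 1) = 0 := by push_cast at this; linarith
      exact mul_eq_zero.1 this
    omega

/-- The parts of a series with exponents in a fixed residue class modulo `3` are eigenvectors of
the Euler operator. -/
theorem eq_zero_of_eigenvectors {f₀ f₁ f₂ : (ZMod 3)⟦X⟧} (h₀ : eulerDeriv f₀ = 0)
    (h₁ : eulerDeriv f₁ = f₁) (h₂ : eulerDeriv f₂ = 2 * f₂) (h : f₀ + f₁ + f₂ = 0) : f₀ = 0 := by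
  have h3 := ZMod.three_eq_zero_powerSeries
  have h2 : eulerDeriv (2 : (ZMod 3)⟦X⟧) = 0 := by exact_mod_cast eulerDeriv.map_natCast 2
  have e1 := congrArg eulerDeriv h
  rw [map_add, map_add, h₀, h₁, h₂, map_zero] at e1
  have e2 := congrArg eulerDeriv e1
  rw [map_add, map_add, eulerDeriv_mul, h₁, h₂, h2, map_zero] at e2
  linear_combination h - e2 + f₂ * h3

/-- The generating function of `n(π) (ℓ(π) + n(π_o))` has exponents congruent to `2` modulo `3`
only. -/
theorem eulerDeriv_genFun_mul :
    eulerDeriv (Overpartition.genFun (ZMod 3) * (sigmaSeries 2 - Overpartition.appellSum)) =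
      -(Overpartition.genFun (ZMod 3) * (sigmaSeries 2 - Overpartition.appellSum)) := by
  have h3 := ZMod.three_eq_zero_powerSeries
  have hP := Overpartition.eulerDeriv_genFun
  have hα := eulerDeriv_thetaSeries_zero
  have hβ := eulerDeriv_thetaSeries_one
  have hψ := eulerDeriv_psiSeries
  have hψ2 := two_mul_psiSeries
  have hW := thetaSeries_mul_appell
  have hW' := thetaSeries_mul_sigmaSeries
  have hM0 := eulerDeriv_appellZero
  have hM2 := eulerDeriv_appellTwo
  have hE1 := eulerDeriv_sigmaSeries one_ne_zero
  have hE2 := eulerDeriv_sigmaSeries two_ne_zero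
  have hE3 := eulerDeriv_sigmaSeries three_ne_zero
  have hE6 := eulerDeriv_sigmaSeries (s := 6) (by norm_num)
  have hα0 := coeff_zero_thetaSeries
  norm_num only [Nat.cast_one, Nat.cast_ofNat] at hE1 hE2 hE3 hE6
  rw [h3, zero_mul] at hE3
  rw [show (6 : (ZMod 3)⟦X⟧) = 0 by linear_combination 2 * h3, zero_mul] at hE6
  rw [appellSum_eq]
  generalize Overpartition.genFun (ZMod 3) = P at *
  generalize thetaSeries 0 = α at *
  generalize thetaSeries 1 = β at *
  generalize weightedTheta = W at *
  generalize appellZero = M₀ at *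
  generalize appellTwo = M₂ at *
  generalize sigmaSeries 1 = E₁ at *
  generalize sigmaSeries 2 = E₂ at *
  generalize sigmaSeries 3 = E₃ at *
  generalize sigmaSeries 6 = E₆ at *
  have hψα : psiSeries = α - β := by
    linear_combination 2 * hψ2 + (α + β - psiSeries) * h3
  rw [hψα, map_sub, hα, hβ] at hψ
  -- the exponents divisible by `3` in `hψ`
  have hres : α * (E₃ - E₆) + β * (E₂ - E₆) = 0 := by
    refine eq_zero_of_eigenvectors (f₁ := β - β * (E₃ - E₆) + α * (E₁ - E₃))
      (f₂ := -(β * (E₁ - E₃)) - α * (E₂ - E₆)) ?_ ?_ ?_ ?_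
    · simp only [map_add, map_sub, eulerDeriv_mul, hα, hβ, hE2, hE3, hE6]
      linear_combination β * (E₂ - E₆) * h3
    · simp only [map_add, map_sub, eulerDeriv_mul, hα, hβ, hE1, hE3, hE6]
      ring
    · simp only [map_neg, map_sub, eulerDeriv_mul, hα, hβ, hE1, hE2, hE3, hE6]
      ring
    · linear_combination -hψ
  have hD : α * (E₆ - M₀) + β * (E₂ - E₆ - M₂) = 0 := by
    linear_combination hres - hW + hW' + α * E₆ * h3
  have hne : β - α ≠ 0 := fun h => by
    have h' := congrArg eulerDeriv h
    rw [map_sub, hα, hβ, map_zero, sub_zero] at h'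
    rw [h', zero_sub, neg_eq_zero] at h
    rw [h, map_zero] at hα0
    exact zero_ne_one hα0
  have hD0 : E₆ - M₀ = (E₁ - E₂) * (E₂ - (M₀ + M₂)) := by
    refine mul_left_cancel₀ hne ?_
    linear_combination -(E₂ - (M₀ + M₂)) * hψ - hD
  rw [eulerDeriv_mul, map_sub, map_add, hP, hM0, hM2, hE2]
  linear_combination -2 * P * hD0 + P * (E₂ - M₀ - M₂) * h3

/-! ### From moments to ranks -/

namespace Overpartition
variable {n : ℕ}

theorem sum_numParts_mul_eq_zero (hn : (1 + n : ZMod 3) ≠ 0) :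
    ∑ π : Overpartition n,
      (π.numParts * (π.largestPart + π.oddNonOverlinedParts.card) : ZMod 3) = 0 := by
  have h := congrArg (coeff n) eulerDeriv_genFun_mul
  rw [coeff_eulerDeriv, map_neg] at h
  have h0 : (1 + n : ZMod 3) * coeff n
      (genFun (ZMod 3) * (sigmaSeries 2 - appellSum)) = 0 := by
    linear_combination h
  have h1 := (mul_eq_zero.1 h0).resolve_left hn
  have h2 : genFun (ZMod 3) * appellSum = statGenFun (fun _ a => (a ^ 2 : ZMod 3)) -
      statGenFun fun l a => (l * a : ZMod 3) := by
    rw [statGenFun_mul]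
    ring
  rw [mul_sub, ← moment_eq, h2, map_sub, map_sub, statGenFun, statGenFun, coeff_mk, coeff_mk,
    coeff_mk, ← Finset.sum_sub_distrib, ← Finset.sum_sub_distrib] at h1
  rw [← h1]
  refine Finset.sum_congr rfl fun π _ => ?_
  rw [← numOddPlain]
  push_cast
  ring

/-- The overlining of the largest part is switched on or off. -/
def toggleLargest (π : Overpartition n) : Overpartition n where
  toPartition := π.toPartition
  overlined := if π.largestPart ∈ π.parts then symmDiff π.overlined {π.largestPart}
    else π.overlined
  overlined_subset := by
    split_ifs with h
    · intro i hi
      rcases Finset.mem_symmDiff.1 hi with ⟨hi, -⟩ | ⟨hi, -⟩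
      · exact π.overlined_subset hi
      · rw [Finset.mem_singleton.1 hi]
        exact Multiset.mem_toFinset.2 h
    · exact π.overlined_subset

theorem toggleLargest_involutive : Function.Involutive (toggleLargest (n := n)) := fun π => by
  refine ext_of_parts rfl ?_
  change (if π.largestPart ∈ π.parts then
    symmDiff (if π.largestPart ∈ π.parts then symmDiff π.overlined {π.largestPart}
      else π.overlined) {π.largestPart} else
        (if π.largestPart ∈ π.parts then symmDiff π.overlined {π.largestPart}
          else π.overlined)) = π.overlined
  split_ifs
  · exact symmDiff_symmDiff_cancel_right _ _
  · rfl

theorem largestPart_mem {π : Overpartition n} (h : π.numParts ≠ 0) :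
    π.largestPart ∈ π.parts := by
  by_contra hmem
  have hlt : ∀ i ∈ π.parts, i < π.largestPart := fun i hi =>
    lt_of_le_of_ne (largestPart_le_iff.1 le_rfl i hi) fun he => hmem (he ▸ hi)
  have hpos : 0 < π.largestPart := by
    obtain ⟨i, hi⟩ := Multiset.exists_mem_of_ne_zero
      (fun h0 => h (by rw [numParts, h0, Multiset.card_zero]) : π.parts ≠ 0)
    exact (Nat.zero_le i).trans_lt (hlt i hi)
  have : π.largestPart ≤ π.largestPart - 1 :=
    largestPart_le_iff.2 fun i hi => Nat.le_sub_one_of_lt (hlt i hi)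
  omega

theorem chi_toggleLargest {π : Overpartition n} (h : π.numParts ≠ 0) :
    π.toggleLargest.chi + π.chi = π.largestPart % 2 := by
  have hl : π.toggleLargest.largestPart = π.largestPart := rfl
  have ho : π.toggleLargest.overlined = symmDiff π.overlined {π.largestPart} :=
    if_pos (largestPart_mem h)
  simp only [chi, hl, ho, Finset.mem_symmDiff, Nat.odd_iff, Finset.mem_singleton]
  by_cases h1 : π.largestPart % 2 = 1 <;> by_cases h2 : π.largestPart ∈ π.overlined <;>
    simp [h1, h2]
  all_goals omega

/-- Switching the overlining of the largest part averages the statistic `χ`. -/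
theorem two_mul_sum_chi :
    2 * ∑ π : Overpartition n, (π.numParts * π.chi : ZMod 3) =
      ∑ π : Overpartition n, (π.numParts * (π.largestPart % 2 : ℕ) : ZMod 3) := by
  have h := Equiv.sum_comp (toggleLargest_involutive (n := n)).toPerm
    fun π : Overpartition n => (π.numParts * π.chi : ZMod 3)
  rw [two_mul]
  nth_rewrite 1 [← h]
  rw [← Finset.sum_add_distrib]
  refine Finset.sum_congr rfl fun π _ => ?_
  rw [Function.Involutive.coe_toPerm]
  by_cases h0 : π.numParts = 0
  · have : π.toggleLargest.numParts = 0 := h0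
    simp [h0, this]
  · have : π.toggleLargest.numParts = π.numParts := rfl
    rw [this, ← mul_add, ← chi_toggleLargest h0]
    push_cast
    rfl

theorem two_mul_ceil_half (l : ℕ) : 2 * ⌈(l : ℚ) / 2⌉ = (l + (l % 2 : ℕ) : ℤ) := by
  have h : ⌈(l : ℚ) / 2⌉ = (((l + l % 2) / 2 : ℕ) : ℤ) := by
    rw [Int.ceil_eq_iff]
    obtain ⟨k, rfl | rfl⟩ := Nat.even_or_odd' l
    · have : (2 * k + 2 * k % 2) / 2 = k := by omega
      rw [this]
      push_cast
      constructor <;> linarith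
    · have : (2 * k + 1 + (2 * k + 1) % 2) / 2 = k + 1 := by omega
      rw [this]
      push_cast
      constructor <;> linarith
  rw [h]
  omega

/-- The total ranks, weighted by the number of parts, agree modulo `3`. -/
theorem sum_numParts_mul_rank (hn : (1 + n : ZMod 3) ≠ 0) :
    ∑ π : Overpartition n, (π.numParts * (π.rank : ZMod 3) : ZMod 3) =
      ∑ π : Overpartition n, (π.numParts * (π.m2Rank : ZMod 3) : ZMod 3) := by
  have h3 : (3 : ZMod 3) = 0 := rfl
  have h1 := sum_numParts_mul_eq_zero hn
  have h2 := two_mul_sum_chi (n := n)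
  have h4 : 2 * (∑ π : Overpartition n, (π.numParts * (π.rank : ZMod 3) : ZMod 3) -
      ∑ π : Overpartition n, (π.numParts * (π.m2Rank : ZMod 3) : ZMod 3)) =
        ∑ π : Overpartition n,
          (π.numParts * (π.largestPart + π.oddNonOverlinedParts.card) : ZMod 3) +
        (2 * ∑ π : Overpartition n, (π.numParts * π.chi : ZMod 3) -
          ∑ π : Overpartition n, (π.numParts * (π.largestPart % 2 : ℕ) : ZMod 3)) := by
    simp only [Finset.mul_sum, ← Finset.sum_sub_distrib, ← Finset.sum_add_distrib]
    refine Finset.sum_congr rfl fun π _ => ?_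
    have hc := congrArg (Int.cast : ℤ → ZMod 3) (two_mul_ceil_half π.largestPart)
    simp only [Int.cast_mul, Int.cast_add, Int.cast_natCast, Int.cast_ofNat] at hc
    rw [rank, m2Rank]
    push_cast
    linear_combination -(π.numParts : ZMod 3) * hc -
      (π.numParts : ZMod 3) * π.oddNonOverlinedParts.card * h3
  rw [h1, h2, sub_self, add_zero] at h4
  exact sub_eq_zero.1 ((mul_eq_zero.1 h4).resolve_left (by decide))

/-- Modulo `3`, a residue is the difference of the indicators of the classes of `1` and `2`. -/
theorem sum_filter_sub_sum_filter (r : Overpartition n → ℤ) :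
    ((∑ π : Overpartition n with r π ≡ 1 [ZMOD ((3 : ℕ) : ℤ)], π.numParts : ℕ) : ZMod 3) -
      ((∑ π : Overpartition n with r π ≡ 2 [ZMOD ((3 : ℕ) : ℤ)], π.numParts : ℕ) : ZMod 3) =
        ∑ π : Overpartition n, (π.numParts * (r π : ZMod 3) : ZMod 3) := by
  have h : ∀ x : ZMod 3, (if x = 1 then 1 else 0) - (if x = 2 then 1 else 0) = x := by decide
  rw [Nat.cast_sum, Nat.cast_sum, Finset.sum_filter, Finset.sum_filter, ← Finset.sum_sub_distrib]
  refine Finset.sum_congr rfl fun π _ => ?_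
  simp only [← ZMod.intCast_eq_intCast_iff, Int.cast_one, Int.cast_ofNat]
  have hx := h (r π : ZMod 3)
  split_ifs at hx ⊢ <;> linear_combination (π.numParts : ZMod 3) * hx

theorem NTbar_sub_modEq (hn : (1 + n : ZMod 3) ≠ 0) :
    (NTbar 1 3 n : ℤ) - (NTbar 2 3 n : ℤ) ≡ (NT2bar 1 3 n : ℤ) - (NT2bar 2 3 n : ℤ) [ZMOD 3] := by
  refine (ZMod.intCast_eq_intCast_iff _ _ 3).1 ?_
  push_cast
  rw [NTbar, NTbar, NT2bar, NT2bar, sum_filter_sub_sum_filter, sum_filter_sub_sum_filter,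
    sum_numParts_mul_rank hn]

end Overpartition

theorem theorem2 (n : ℕ) :
    ((Overpartition.NTbar 1 3 (3 * n) : ℤ) - (Overpartition.NTbar 2 3 (3 * n) : ℤ) ≡
        (Overpartition.NT2bar 1 3 (3 * n) : ℤ) - (Overpartition.NT2bar 2 3 (3 * n) : ℤ)
          [ZMOD 3]) ∧
      ((Overpartition.NTbar 1 3 (3 * n + 1) : ℤ) - (Overpartition.NTbar 2 3 (3 * n + 1) : ℤ) ≡
        (Overpartition.NT2bar 1 3 (3 * n + 1) : ℤ) - (Overpartition.NT2bar 2 3 (3 * n + 1) : ℤ)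
          [ZMOD 3]) := by
  have h3 : (3 : ZMod 3) = 0 := rfl
  refine ⟨Overpartition.NTbar_sub_modEq ?_, Overpartition.NTbar_sub_modEq ?_⟩
  · push_cast
    rw [h3, zero_mul]
    decide
  · push_cast
    rw [h3, zero_mul]
    decide
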